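/- **Unconditional stability of the two-dimensional factored fourth-order scheme.** *Discretization matrices.* Let $1<\alpha<2$. Let $g_0^\alpha=1$, $g_k^\alpha=(1-\frac{\alpha+1}{k})g_{k-1}^\alpha$ for $k\ge1$, and $q_k^\alpha=(\tfrac32)^\alpha\sum_{m=0}^k 3^{-m}g_m^\alpha g_{k-m}^\alpha$ for $k\ge 0$ (the power series coefficients of $(\frac32-2\zeta+\frac12\zeta^2)^\alpha$), $q_k^\alpha=0$ for $k<0$. For integers $p,q,r,s$ and a given size $n$ let $A_p^\alpha=(q^\alpha_{i-j+p})_{i,j=1}^{n}$, $$A^\alpha_{p,q}=\tfrac{q}{q-p}A^\alpha_p+\tfrac{p}{p-q}A^\alpha_q,\qquad A^\alpha_{p,q,r,s}=\tfrac{3rs+2\alpha}{3(rs-pq)}A^\alpha_{p,q}+\tfrac{3pq+2\alpha}{3(pq-rs)}A^\alpha_{r,s}.$$ Put $a=rs-pq$, $b=6pqrs(r+s-p-q)+4\alpha[rs(r+s)-pq(p+q)]+9\alpha(rs-pq)$, let $\bar a,\bar b$ be the same expressions in $\bar p,\bar q,\bar r,\bar s$, and $$A_\alpha=\frac{a\bar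 b}{a\bar b-\bar a b}A^\alpha_{p,q,r,s}+\frac{\bar a b}{\bar a b-a\bar b}A^\alpha_{\bar p,\bar q,\bar r,\bar s}.$$ Let the shifts $(p,q,r,s,\bar p,\bar q,\bar r,\bar s)$ be one of: $(1,2,1,-2,1,\bar q,1,\bar s)$ with $|\bar q|,|\bar s|\ge2$, $\bar q\bar s<0$, $(\bar q,\bar s)\ne(2,-2)$; $(1,2,1,0,1,2,1,-2)$; $(1,2,1,0,1,-1,1,-2)$; $(1,2,1,-1,1,2,1,-2)$; $(1,2,1,-1,1,-1,1,-2)$; $(1,0,1,-1,1,2,1,-2)$; $(1,0,1,-2,1,2,1,-2)$; $(1,-1,1,-2,1,2,1,-2)$. *The scheme.* Let $1<\alpha,\beta<2$, $x_L<x_R$, $y_L<y_R$; fix shifts from this list, the same for $\alpha$ and $\beta$, with $a\bar b\ne\bar a b$ both for $\alpha$ and for $\beta$. Let $d_\pm$ and $e_\pm$ be real functions of $x$ and of $y$, respectively, with $d_+\ge0$ on $(x_L,x_R)$ and $e_+\ge0$ on $(y_L,y_R)$. For integers $N_x,N_y\ge1$ and $\tau>0$ put $\Delta x=(x_R-x_L)/N_x$,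 $\Delta y=(y_R-y_L)/N_y$, $x_i=x_L+i\Delta x$, $y_j=y_L+j\Delta y$, $D_\pm=\mathrm{diag}(d_\pm(x_i))_{i=1}^{N_x-1}$, $E_\pm=\mathrm{diag}(e_\pm(y_j))_{j=1}^{N_y-1}$. With $A_\alpha$ of size $N_x-1$ and $A_\beta$ of size $N_y-1$, let $$\mathcal A_x=\frac{\tau}{2(\Delta x)^\alpha}\,I\otimes(D_+A_\alpha+D_-A_\alpha^T),\qquad \mathcal A_y=\frac{\tau}{2(\Delta y)^\beta}\,(E_+A_\beta+E_-A_\beta^T)\otimes I,$$ and consider, for arbitrary sources $\mathbf F^{n+1/2}$ and arbitrarily many time steps, the factored scheme $$(I-\mathcal A_x)(I-\mathcal A_y)\mathbf U^{n+1}=(I+\mathcal A_x)(I+\mathcal A_y)\mathbf U^n+\tau\mathbf F^{n+1/2}.$$ *Theorem.* Suppose that $D_-=\kappa_\alpha D_+$ and $E_-=\kappa_\beta E_+$ on all grids, with constants $\kappa_\alpha,\kappa_\beta\ge0$. Then the scheme is unconditionally stable, in the following sense. 1. For all $N_x,N_y\ge1$ and $\tau>0$ the matrix $(I-\mathcal A_x)(I-\mathcal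 A_y)$ is invertible. 2. For all $N_x,N_y\ge1$ there is a constant $K$, independent of $\tau>0$, of the number of time steps and of the source, such that any two solutions $\mathbf U,\mathbf V$ of the scheme with the same source satisfy $\|\mathbf V^n-\mathbf U^n\|_2\le K\|\mathbf V^0-\mathbf U^0\|_2$ at all time levels $n$. 3. For all $N_x,N_y\ge1$ such that $d_+(x_i)>0$ for $1\le i\le N_x-1$ and $e_+(y_j)>0$ for $1\le j\le N_y-1$, and for all $\tau>0$, the spectral radius of the amplification matrix $[(I-\mathcal A_x)(I-\mathcal A_y)]^{-1}(I+\mathcal A_x)(I+\mathcal A_y)$ is less than $1$. 4. If there are constants $0<c\le M$ with $c\le d_+\le M$ on $(x_L,x_R)$ and constants $0<c'\le M'$ with $c'\le e_+\le M'$ on $(y_L,y_R)$, then the constant $K$ in 2 can be chosen independently of $N_x$ and $N_y$ as well. -/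

import Mathlib

open scoped Kronecker Matrix

noncomputable section

namespace WSLD

/-- Coefficients `g_k` of the power series of `(1 - ζ) ^ α`:
`g_0 = 1`, `g_k = (1 - (α + 1) / k) g_{k-1}`. -/
def g (α : ℝ) : ℕ → ℝ
  | 0 => 1
  | k + 1 => (1 - (α + 1) / ((k : ℝ) + 1)) * g α k

/-- Lubich's second order coefficients `q_k`, i.e. the coefficients of the power series of
`(3/2 - 2 ζ + ζ² / 2) ^ α`, extended by `0` to negative indices. -/
def q (α : ℝ) (k : ℤ) : ℝ :=
  if k < 0 then 0
  else (3 / 2 : ℝ) ^ α *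
    ∑ m ∈ Finset.range (k.toNat + 1), ((3 : ℝ) ^ m)⁻¹ * g α m * g α (k.toNat - m)

/-- The `n × n` Toeplitz matrix `A_p` of the Lubich operator shifted by `p`. -/
def A1 (α : ℝ) (n : ℕ) (p : ℤ) : Matrix (Fin n) (Fin n) ℝ :=
  Matrix.of fun i j => q α ((i : ℤ) - (j : ℤ) + p)

/-- The second order combination `A_{p,q} = w_p A_p + w_q A_q`,
`w_p = q / (q - p)`, `w_q = p / (p - q)`. -/
def A2 (α : ℝ) (n : ℕ) (p q : ℤ) : Matrix (Fin n) (Fin n) ℝ :=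
  ((q : ℝ) / ((q : ℝ) - p)) • A1 α n p + ((p : ℝ) / ((p : ℝ) - q)) • A1 α n q

/-- The third order combination `A_{p,q,r,s} = w_{p,q} A_{p,q} + w_{r,s} A_{r,s}`. -/
def A3 (α : ℝ) (n : ℕ) (p q r s : ℤ) : Matrix (Fin n) (Fin n) ℝ :=
  ((3 * (r : ℝ) * s + 2 * α) / (3 * ((r : ℝ) * s - (p : ℝ) * q))) • A2 α n p q +
    ((3 * (p : ℝ) * q + 2 * α) / (3 * ((p : ℝ) * q - (r : ℝ) * s))) • A2 α n r s

/-- `a_{p,q,r,s} = r s - p q`. -/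
def coefA (p q r s : ℝ) : ℝ := r * s - p * q

/-- `b_{p,q,r,s} = 6 p q r s (r+s-p-q) + 4 α [r s (r+s) - p q (p+q)] + 9 α (r s - p q)`. -/
def coefB (α p q r s : ℝ) : ℝ :=
  6 * p * q * r * s * (r + s - p - q) + 4 * α * (r * s * (r + s) - p * q * (p + q)) +
    9 * α * (r * s - p * q)

/-- The eight integer shifts of a fourth order operator; a prime stands for a bar. -/
structure Shifts where
  p : ℤ
  q : ℤ
  r : ℤ
  s : ℤ
  p' : ℤ
  q' : ℤ
  r' : ℤ
  s' : ℤ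

/-- `a b̄`. -/
def Shifts.ab' (S : Shifts) (α : ℝ) : ℝ :=
  coefA S.p S.q S.r S.s * coefB α S.p' S.q' S.r' S.s'

/-- `ā b`. -/
def Shifts.a'b (S : Shifts) (α : ℝ) : ℝ :=
  coefA S.p' S.q' S.r' S.s' * coefB α S.p S.q S.r S.s

/-- The fourth order weights are defined: `a b̄ ≠ ā b`. -/
def Shifts.Nondegenerate (S : Shifts) (α : ℝ) : Prop := S.ab' α ≠ S.a'b α

/-- The fourth order WSLD matrix
`A_α = w_{p,q,r,s} A_{p,q,r,s} + w_{p̄,q̄,r̄,s̄} A_{p̄,q̄,r̄,s̄}` of size `n × n`. -/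
def A4 (α : ℝ) (S : Shifts) (n : ℕ) : Matrix (Fin n) (Fin n) ℝ :=
  (S.ab' α / (S.ab' α - S.a'b α)) • A3 α n S.p S.q S.r S.s +
    (S.a'b α / (S.a'b α - S.ab' α)) • A3 α n S.p' S.q' S.r' S.s'

/-- The shifts for which the fourth order discretization is effective: the infinite family
`(1,2,1,-2,1,q̄,1,s̄)` and seven further choices. -/
def Shifts.Effective (S : Shifts) : Prop :=
  (∃ q' s' : ℤ, S = ⟨1, 2, 1, -2, 1, q', 1, s'⟩ ∧ 2 ≤ |q'| ∧ 2 ≤ |s'| ∧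
      (q', s') ≠ (2, -2) ∧ q' * s' < 0) ∨
    S = ⟨1, 2, 1, 0, 1, 2, 1, -2⟩ ∨
    S = ⟨1, 2, 1, 0, 1, -1, 1, -2⟩ ∨
    S = ⟨1, 2, 1, -1, 1, 2, 1, -2⟩ ∨
    S = ⟨1, 2, 1, -1, 1, -1, 1, -2⟩ ∨
    S = ⟨1, 0, 1, -1, 1, 2, 1, -2⟩ ∨
    S = ⟨1, 0, 1, -2, 1, 2, 1, -2⟩ ∨
    S = ⟨1, -1, 1, -2, 1, 2, 1, -2⟩

/-- Interior grid point number `i + 1` of the uniform grid on `[L, R]` with `N` cells. -/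
def gridPoint (L R : ℝ) (N : ℕ) (i : Fin (N - 1)) : ℝ :=
  L + ((i : ℝ) + 1) * ((R - L) / N)

/-- Diagonal matrix of the values of `d` at the interior grid points. -/
def coeffMatrix (d : ℝ → ℝ) (L R : ℝ) (N : ℕ) : Matrix (Fin (N - 1)) (Fin (N - 1)) ℝ :=
  Matrix.diagonal fun i => d (gridPoint L R N i)

/-- The data of the space discretization of
`u_t = d₊(x) D_{x+}^α u + d₋(x) D_{x-}^α u + e₊(y) D_{y+}^β u + e₋(y) D_{y-}^β u + f`
on `(xL, xR) × (yL, yR)`. -/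
structure Problem where
  α : ℝ
  β : ℝ
  xL : ℝ
  xR : ℝ
  yL : ℝ
  yR : ℝ
  dPlus : ℝ → ℝ
  dMinus : ℝ → ℝ
  ePlus : ℝ → ℝ
  eMinus : ℝ → ℝ
  shifts : Shifts

namespace Problem

variable (P : Problem)

/-- `D₊`. -/
def DPlus (Nx : ℕ) : Matrix (Fin (Nx - 1)) (Fin (Nx - 1)) ℝ := coeffMatrix P.dPlus P.xL P.xR Nx

/-- `D₋`. -/
def DMinus (Nx : ℕ) : Matrix (Fin (Nx - 1)) (Fin (Nx - 1)) ℝ := coeffMatrix P.dMinus P.xL P.xR Nx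

/-- `E₊`. -/
def EPlus (Ny : ℕ) : Matrix (Fin (Ny - 1)) (Fin (Ny - 1)) ℝ := coeffMatrix P.ePlus P.yL P.yR Ny

/-- `E₋`. -/
def EMinus (Ny : ℕ) : Matrix (Fin (Ny - 1)) (Fin (Ny - 1)) ℝ := coeffMatrix P.eMinus P.yL P.yR Ny

end Problem

/-- Index set of the interior nodes. The node `(j, i)` carries `u_{i+1, j+1}`; the `x`-index
`i` runs fastest, so the `y`-index is the first Kronecker factor. -/
abbrev Node (Nx Ny : ℕ) : Type := Fin (Ny - 1) × Fin (Nx - 1)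

namespace Problem

variable (P : Problem)

/-- `𝒜_x = τ / (2 Δx^α) • I ⊗ (D₊ A_α + D₋ A_αᵀ)` with `Δx = (xR - xL) / Nx`. -/
def calAx (Nx Ny : ℕ) (τ : ℝ) : Matrix (Node Nx Ny) (Node Nx Ny) ℝ :=
  (τ / (2 * ((P.xR - P.xL) / Nx) ^ P.α)) •
    ((1 : Matrix (Fin (Ny - 1)) (Fin (Ny - 1)) ℝ) ⊗ₖ
      (P.DPlus Nx * A4 P.α P.shifts (Nx - 1) + P.DMinus Nx * (A4 P.α P.shifts (Nx - 1))ᵀ))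

/-- `𝒜_y = τ / (2 Δy^β) • (E₊ A_β + E₋ A_βᵀ) ⊗ I` with `Δy = (yR - yL) / Ny`. -/
def calAy (Nx Ny : ℕ) (τ : ℝ) : Matrix (Node Nx Ny) (Node Nx Ny) ℝ :=
  (τ / (2 * ((P.yR - P.yL) / Ny) ^ P.β)) •
    ((P.EPlus Ny * A4 P.β P.shifts (Ny - 1) + P.EMinus Ny * (A4 P.β P.shifts (Ny - 1))ᵀ) ⊗ₖ
      (1 : Matrix (Fin (Nx - 1)) (Fin (Nx - 1)) ℝ))

/-- `(I - 𝒜_x)(I - 𝒜_y)`. -/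
def implicitMatrix (Nx Ny : ℕ) (τ : ℝ) : Matrix (Node Nx Ny) (Node Nx Ny) ℝ :=
  (1 - P.calAx Nx Ny τ) * (1 - P.calAy Nx Ny τ)

/-- `(I + 𝒜_x)(I + 𝒜_y)`. -/
def explicitMatrix (Nx Ny : ℕ) (τ : ℝ) : Matrix (Node Nx Ny) (Node Nx Ny) ℝ :=
  (1 + P.calAx Nx Ny τ) * (1 + P.calAy Nx Ny τ)

/-- Amplification matrix `[(I - 𝒜_x)(I - 𝒜_y)]⁻¹ (I + 𝒜_x)(I + 𝒜_y)` of the scheme. -/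
def amplification (Nx Ny : ℕ) (τ : ℝ) : Matrix (Node Nx Ny) (Node Nx Ny) ℝ :=
  (P.implicitMatrix Nx Ny τ)⁻¹ * P.explicitMatrix Nx Ny τ

/-- `U^0, …, U^{Nt}` solves the factored scheme
`(I - 𝒜_x)(I - 𝒜_y) U^{n+1} = (I + 𝒜_x)(I + 𝒜_y) U^n + τ F^{n+1/2}`, `0 ≤ n < Nt`;
`F n` stands for `F^{n+1/2}`. -/
def IsSolution (Nx Ny : ℕ) (τ : ℝ) (Nt : ℕ) (F U : ℕ → Node Nx Ny → ℝ) : Prop :=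
  ∀ n < Nt, P.implicitMatrix Nx Ny τ *ᵥ U (n + 1) =
    P.explicitMatrix Nx Ny τ *ᵥ U n + τ • F n

/-- Stability with constant `K` on a given grid with time step `τ`: for any number of time
steps and any source, a perturbation of the initial grid function is amplified at most by the
factor `K` in the Euclidean norm, at every time level. -/
def StableWith (Nx Ny : ℕ) (τ K : ℝ) : Prop :=
  ∀ (Nt : ℕ) (F U V : ℕ → Node Nx Ny → ℝ),
    P.IsSolution Nx Ny τ Nt F U → P.IsSolution Nx Ny τ Nt F V →
      ∀ n ≤ Nt, ‖WithLp.toLp 2 (V n - U n)‖ ≤ K * ‖WithLp.toLp 2 (V 0 - U 0)‖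

end Problem

end WSLD

end

/-! In each direction the scheme is built from `diagonal d * H` with `H = A_α + κ A_αᵀ`, so
everything rests on one fact: `A_α` is negative definite (`A4_neg_def`).

Negative definiteness. The quadratic form of a Toeplitz matrix at `v` is the mean over the circle of
`|trigPoly v|²` times the real part of the symbol. With `z = e^{-ix}` and `V = lubich z`, the shift
`p` contributes `Re (V ^ α z ^ p)`. Since `1 < α < 2`, `V ^ α` is a positive combination of `V` and
`V ^ 2` (`cpow_eq_combination`), so the fractional power disappears; `Re (V z ^ p)` and `Re (V ^ 2 z
^ p)` are polynomials in `σ = (1 - Re z) / 2 = sin² (x / 2)` for each fixed shift. Apart from two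
exceptional choices, the stencils are positive combinations of `fourthOrder α n`, which uses the
shifts `1, 2, -2, n` and equals `thirdOrder α` plus a multiple of a third divided difference in the
shift. For `|n| ≥ 3` that difference is bounded uniformly in `n` by interpolation remainders on the
unit circle; for `n = 0, -1` it is an explicit polynomial. The two exceptional choices involve five
shifts and are settled by Bernstein expansions (`stencil4_realSymbol_neg`).

Stability. If `X` and `Y` commute and are both dissipative in the inner product of one positive
definite `M`, then `energy M ((1 + X) v) - energy M ((1 - X) v) = 4 ⟨v, X v⟩_M ≤ 0`, so a step of
the factored scheme does not increase the energy. For `d > 0` the weight `D⁻¹` makes `D H`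
dissipative; where `d` may vanish, `Hᵀ D H` plus the projection onto the zero set of `d` does. The
Kronecker product of the two one-dimensional weights serves both directions at once. These weights
do not involve `τ`, hence neither does the stability constant; for coefficients bounded above and
below, the condition number of `E⁻¹ ⊗ D⁻¹` is bounded independently of the grid. -/

noncomputable section

namespace WSLD

/-! ### Interpolation remainders of powers on the unit circle -/

section Remainders

variable {w : ℂ}

/-- Remainder of the interpolation of `j ↦ w ^ j` at `0, 1`. -/
lemma norm_pow_sub_interp01_le (hw : ‖w‖ = 1) (N : ℕ) :
    ‖w ^ N - (1 + N * (w - 1))‖ ≤ (N * (N - 1) / 2 : ℝ) * ‖w - 1‖ ^ 2 := by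
  induction N with
  | zero => simp
  | succ N ih =>
    -- The remainder at `N + 1` is `w` times the remainder at `N` plus a multiple of `(w - 1) ^ 2`,
    -- and `‖w‖ = 1` lets the bounds add up. The other remainders below obey the same recursion, the
    -- cofactor being a quadratic in `w` with nonnegative coefficients.
    have e : w ^ (N + 1) - (1 + ((N + 1 : ℕ) : ℂ) * (w - 1)) =
        w * (w ^ N - (1 + N * (w - 1))) + N * (w - 1) ^ 2 := by push_cast; ring
    rw [e]
    refine (norm_add_le _ _).trans ?_
    rw [norm_mul, norm_mul, hw, norm_pow, Complex.norm_natCast]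
    push_cast
    linarith

lemma norm_quadratic_le (hw : ‖w‖ = 1) {a b c : ℝ} (ha : 0 ≤ a) (hb : 0 ≤ b) (hc : 0 ≤ c) :
    ‖(a + b * w + c * w ^ 2 : ℂ)‖ ≤ a + b + c := by
  refine norm_add₃_le.trans ?_
  rw [norm_mul, norm_mul, norm_pow, hw, Complex.norm_real, Complex.norm_real, Complex.norm_real,
    Real.norm_of_nonneg ha, Real.norm_of_nonneg hb, Real.norm_of_nonneg hc]
  linarith

/-- Remainder of the interpolation of `j ↦ w ^ j` at `0, 3`. -/
lemma norm_pow_sub_interp03_le (hw : ‖w‖ = 1) (N : ℕ) (hN : 3 ≤ N) :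
    ‖w ^ N - (1 + N / 3 * (w ^ 3 - 1))‖ ≤ (N * (N - 3) / 2 : ℝ) * ‖w - 1‖ ^ 2 := by
  induction N, hN using Nat.le_induction with
  | base => norm_num
  | succ N hN ih =>
    have hN' : (3 : ℝ) ≤ N := by exact_mod_cast hN
    have e : w ^ (N + 1) - (1 + ((N + 1 : ℕ) : ℂ) / 3 * (w ^ 3 - 1)) =
        w * (w ^ N - (1 + N / 3 * (w ^ 3 - 1))) +
          (((N - 2 : ℝ) / 3 : ℝ) + ((N - 1 : ℝ) / 3 : ℝ) * w + ((N : ℝ) / 3 : ℝ) * w ^ 2) *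
            (w - 1) ^ 2 := by
      push_cast; ring
    rw [e]
    have h := norm_quadratic_le hw (a := (N - 2) / 3) (b := (N - 1) / 3) (c := N / 3)
      (by linarith) (by linarith) (by linarith)
    refine (norm_add_le _ _).trans ?_
    rw [norm_mul, norm_mul, hw, norm_pow]
    push_cast at h ⊢
    nlinarith [mul_le_mul_of_nonneg_right h (sq_nonneg ‖w - 1‖)]

/-- Remainder of the interpolation of `j ↦ w ^ j` at `0, 3, 4`. -/
lemma norm_pow_sub_interp034_le (hw : ‖w‖ = 1) (N : ℕ) (hN : 4 ≤ N) :
    ‖w ^ N - ((N - 3) * (N - 4) / 12 - w ^ 3 * (N * (N - 4) / 3) + w ^ 4 * (N * (N - 3) / 4))‖ ≤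
      (N * (N - 3) * (N - 4) / 6 : ℝ) * ‖w - 1‖ ^ 3 := by
  induction N, hN using Nat.le_induction with
  | base => norm_num
  | succ N hN ih =>
    have hN' : (4 : ℝ) ≤ N := by exact_mod_cast hN
    have e : w ^ (N + 1) - ((((N + 1 : ℕ) : ℂ) - 3) * (((N + 1 : ℕ) : ℂ) - 4) / 12 -
          w ^ 3 * (((N + 1 : ℕ) : ℂ) * (((N + 1 : ℕ) : ℂ) - 4) / 3) +
          w ^ 4 * (((N + 1 : ℕ) : ℂ) * (((N + 1 : ℕ) : ℂ) - 3) / 4)) =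
        w * (w ^ N - ((N - 3) * (N - 4) / 12 - w ^ 3 * (N * (N - 4) / 3) +
          w ^ 4 * (N * (N - 3) / 4))) +
          (((N - 2) * (N - 3) / 12 : ℝ) + ((N - 3) * (N - 1) / 6 : ℝ) * w +
            (N * (N - 3) / 4 : ℝ) * w ^ 2) * (w - 1) ^ 3 := by
      push_cast; ring
    rw [e]
    have h := norm_quadratic_le hw (a := (N - 2) * (N - 3) / 12) (b := (N - 3) * (N - 1) / 6)
      (c := N * (N - 3) / 4) (by nlinarith) (by nlinarith) (by nlinarith)
    refine (norm_add_le _ _).trans ?_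
    rw [norm_mul, norm_mul, hw, norm_pow]
    push_cast at h ⊢
    nlinarith [mul_le_mul_of_nonneg_right h (pow_nonneg (norm_nonneg (w - 1)) 3)]

/-- Remainder of the interpolation of `j ↦ w ^ j` at `0, 1, 4`. -/
lemma norm_pow_sub_interp014_le (hw : ‖w‖ = 1) (N : ℕ) (hN : 4 ≤ N) :
    ‖w ^ N - ((N - 1) * (N - 4) / 4 - w * (N * (N - 4) / 3) + w ^ 4 * (N * (N - 1) / 12))‖ ≤
      (N * (N - 1) * (N - 4) / 6 : ℝ) * ‖w - 1‖ ^ 3 := by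
  induction N, hN using Nat.le_induction with
  | base => norm_num
  | succ N hN ih =>
    have hN' : (4 : ℝ) ≤ N := by exact_mod_cast hN
    have e : w ^ (N + 1) - ((((N + 1 : ℕ) : ℂ) - 1) * (((N + 1 : ℕ) : ℂ) - 4) / 4 -
          w * (((N + 1 : ℕ) : ℂ) * (((N + 1 : ℕ) : ℂ) - 4) / 3) +
          w ^ 4 * (((N + 1 : ℕ) : ℂ) * (((N + 1 : ℕ) : ℂ) - 1) / 12)) =
        w * (w ^ N - ((N - 1) * (N - 4) / 4 - w * (N * (N - 4) / 3) +
          w ^ 4 * (N * (N - 1) / 12))) +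
          ((N * (N - 3) / 4 : ℝ) + (N * (N - 2) / 6 : ℝ) * w +
            (N * (N - 1) / 12 : ℝ) * w ^ 2) * (w - 1) ^ 3 := by
      push_cast; ring
    rw [e]
    have h := norm_quadratic_le hw (a := N * (N - 3) / 4) (b := N * (N - 2) / 6)
      (c := N * (N - 1) / 12) (by nlinarith) (by nlinarith) (by nlinarith)
    refine (norm_add_le _ _).trans ?_
    rw [norm_mul, norm_mul, hw, norm_pow]
    push_cast at h ⊢
    nlinarith [mul_le_mul_of_nonneg_right h (pow_nonneg (norm_nonneg (w - 1)) 3)]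

end Remainders

/-! ### Third divided differences of `p ↦ z ^ p` in the shift -/

/-- The divided difference of `φ` at the nodes `1, 2, -2, n`. -/
def dividedDiff {E : Type*} [AddCommGroup E] [Module ℝ E] (n : ℤ) (φ : ℤ → E) : E :=
  (1 / (3 * ((n : ℝ) - 1))) • φ 1 - (1 / (4 * ((n : ℝ) - 2))) • φ 2 -
    (1 / (12 * ((n : ℝ) + 2))) • φ (-2) +
    (1 / (((n : ℝ) - 1) * ((n : ℝ) - 2) * ((n : ℝ) + 2))) • φ n

lemma norm_inv_sub_one {z : ℂ} (hz : ‖z‖ = 1) : ‖z⁻¹ - 1‖ = ‖z - 1‖ := by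
  have h0 : z ≠ 0 := by rintro rfl; simp at hz
  have : z⁻¹ - 1 = -(z⁻¹ * (z - 1)) := by field_simp; ring
  rw [this, norm_neg, norm_mul, norm_inv, hz]; simp

/-- A divided difference is an interpolation remainder over the node polynomial. Multiplying by `z ^
2` moves the nodes `-2, 1, 2` to `0, 3, 4`; for negative `n` one passes to `z⁻¹` and they become `0,
1, 4`. This bound has the right order as `z → 1`. -/
lemma norm_dividedDiff_zpow_le_cube {z : ℂ} (hz : ‖z‖ = 1) {n : ℤ} (hn : 3 ≤ |n|) :
    ‖dividedDiff n (fun p => z ^ p)‖ ≤ ‖z - 1‖ ^ 3 / 6 := by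
  have h0 : z ≠ 0 := by rintro rfl; simp at hz
  rcases le_abs.mp hn with h | h
  · obtain ⟨m, rfl⟩ := Int.eq_ofNat_of_zero_le (show 0 ≤ n by omega)
    have hm : 3 ≤ m := by omega
    have hm' : (3 : ℝ) ≤ m := by exact_mod_cast hm
    have hR := norm_pow_sub_interp034_le hz (m + 2) (by omega)
    have h1 : ((m : ℂ) - 1) ≠ 0 := by
      intro h; have : (m : ℝ) - 1 = 0 := by exact_mod_cast h
      linarith
    have h2 : ((m : ℂ) - 2) ≠ 0 := by
      intro h; have : (m : ℝ) - 2 = 0 := by exact_mod_cast h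
      linarith
    have h3 : ((m : ℂ) + 2) ≠ 0 := by
      intro h; have : (m : ℝ) + 2 = 0 := by exact_mod_cast h
      linarith
    have e : dividedDiff (m : ℤ) (fun p => z ^ p) =
        ((1 / (((m : ℝ) - 1) * ((m : ℝ) - 2) * ((m : ℝ) + 2)) : ℝ) : ℂ) * ((z ^ 2)⁻¹ *
        (z ^ (m + 2) - ((((m + 2 : ℕ) : ℂ) - 3) * (((m + 2 : ℕ) : ℂ) - 4) / 12 -
          z ^ 3 * (((m + 2 : ℕ) : ℂ) * (((m + 2 : ℕ) : ℂ) - 4) / 3) +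
          z ^ 4 * (((m + 2 : ℕ) : ℂ) * (((m + 2 : ℕ) : ℂ) - 3) / 4)))) := by
      simp only [dividedDiff, Complex.real_smul, zpow_natCast, zpow_one, zpow_neg]
      rw [show (z ^ (2 : ℤ)) = z ^ 2 from zpow_natCast z 2]
      push_cast
      field_simp
      ring
    rw [e, norm_mul, norm_mul, norm_inv, norm_pow, hz, Complex.norm_real,
      Real.norm_of_nonneg (by
        have : (0 : ℝ) ≤ ((m : ℝ) - 1) * (m - 2) * (m + 2) := by
          apply mul_nonneg (mul_nonneg _ _) <;> linarith
        positivity)]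
    rw [div_mul_eq_mul_div, div_le_iff₀ (by
      apply mul_pos (mul_pos _ _) <;> linarith)]
    push_cast at hR ⊢
    norm_num
    refine hR.trans (le_of_eq ?_)
    ring
  · obtain ⟨m, hm0⟩ := Int.eq_ofNat_of_zero_le (show 0 ≤ -n by omega)
    obtain rfl : n = -(m : ℤ) := by omega
    have hm : 3 ≤ m := by omega
    have hm' : (3 : ℝ) ≤ m := by exact_mod_cast hm
    have hw : ‖z⁻¹‖ = 1 := by rw [norm_inv, hz, inv_one]
    have hR := norm_pow_sub_interp014_le hw (m + 2) (by omega)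
    rw [norm_inv_sub_one hz] at hR
    have h1 : ((m : ℂ) + 1) ≠ 0 := by
      intro h; have : (m : ℝ) + 1 = 0 := by exact_mod_cast h
      linarith
    have h2 : ((m : ℂ) + 2) ≠ 0 := by
      intro h; have : (m : ℝ) + 2 = 0 := by exact_mod_cast h
      linarith
    have h3 : ((m : ℂ) - 2) ≠ 0 := by
      intro h; have : (m : ℝ) - 2 = 0 := by exact_mod_cast h
      linarith
    have e : dividedDiff (-(m : ℤ)) (fun p => z ^ p) =
        -((1 / (((m : ℝ) + 1) * ((m : ℝ) + 2) * ((m : ℝ) - 2)) : ℝ) : ℂ) * (z ^ 2 *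
        (z⁻¹ ^ (m + 2) - ((((m + 2 : ℕ) : ℂ) - 1) * (((m + 2 : ℕ) : ℂ) - 4) / 4 -
          z⁻¹ * (((m + 2 : ℕ) : ℂ) * (((m + 2 : ℕ) : ℂ) - 4) / 3) +
          z⁻¹ ^ 4 * (((m + 2 : ℕ) : ℂ) * (((m + 2 : ℕ) : ℂ) - 1) / 12)))) := by
      simp only [dividedDiff, Complex.real_smul, zpow_natCast, zpow_one, zpow_neg, inv_pow]
      rw [show (z ^ (2 : ℤ)) = z ^ 2 from zpow_natCast z 2]
      push_cast
      rw [show (-(m : ℂ) - 1) = -(m + 1) by ring, show (-(m : ℂ) - 2) = -(m + 2) by ring,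
        show (-(m : ℂ) + 2) = -(m - 2) by ring]
      field_simp
      ring
    rw [e, norm_mul, norm_neg, norm_mul, norm_pow, hz, Complex.norm_real,
      Real.norm_of_nonneg (by
        have : (0 : ℝ) ≤ ((m : ℝ) + 1) * (m + 2) * (m - 2) := by
          apply mul_nonneg (mul_nonneg _ _) <;> linarith
        positivity)]
    rw [div_mul_eq_mul_div, div_le_iff₀ (by
      apply mul_pos (mul_pos _ _) <;> linarith)]
    push_cast at hR ⊢
    norm_num
    norm_num at hR
    refine hR.trans (le_of_eq ?_)
    ring

/-- The divided difference of `p ↦ z ^ p` at `-2, 1, 2`. -/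
def secondDiff (z : ℂ) : ℂ := (z - 1) ^ 2 * (3 + 2 * z⁻¹ + z⁻¹ ^ 2) / 12

/-- The recursion for divided differences drops one node: `2` is exchanged for `n < 0`, or `-2` for
`n > 0`, and the denominator `|n| + 2` is at least `5`. This bound is the better one far from `z =
1`. -/
lemma norm_dividedDiff_zpow_le_sq {z : ℂ} (hz : ‖z‖ = 1) {n : ℤ} (hn : 3 ≤ |n|) :
    ‖dividedDiff n (fun p => z ^ p)‖ ≤ (‖z - 1‖ ^ 2 / 2 + ‖secondDiff z‖) / 5 := by
  have h0 : z ≠ 0 := by rintro rfl; simp at hz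
  rcases le_abs.mp hn with h | h
  · obtain ⟨m, rfl⟩ := Int.eq_ofNat_of_zero_le (show 0 ≤ n by omega)
    obtain ⟨k, rfl⟩ : ∃ k, m = k + 1 := ⟨m - 1, by omega⟩
    have hm : 2 ≤ k := by omega
    have hm' : (2 : ℝ) ≤ k := by exact_mod_cast hm
    have hR := norm_pow_sub_interp01_le hz k
    have h1 : (k : ℂ) ≠ 0 := by
      intro h; have : (k : ℝ) = 0 := by exact_mod_cast h
      linarith
    have h2 : ((k : ℂ) - 1) ≠ 0 := by
      intro h; have : (k : ℝ) - 1 = 0 := by exact_mod_cast h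
      linarith
    have h3 : ((k : ℂ) + 3) ≠ 0 := by
      intro h; have : (k : ℝ) + 3 = 0 := by exact_mod_cast h
      linarith
    have e : dividedDiff ((k + 1 : ℕ) : ℤ) (fun p => z ^ p) =
        ((1 / ((k : ℝ) + 3) : ℝ) : ℂ) * (((1 / ((k : ℝ) * (k - 1)) : ℝ) : ℂ) * (z *
        (z ^ k - (1 + k * (z - 1)))) - secondDiff z) := by
      simp only [dividedDiff, Complex.real_smul, zpow_natCast, zpow_one, zpow_neg, secondDiff, inv_pow]
      rw [show (z ^ (2 : ℤ)) = z ^ 2 from zpow_natCast z 2]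
      push_cast
      rw [show ((k : ℂ) + 1 - 1) = k by ring, show ((k : ℂ) + 1 - 2) = k - 1 by ring,
        show ((k : ℂ) + 1 + 2) = k + 3 by ring]
      field_simp
      ring
    have hb : ‖((1 / ((k : ℝ) * (k - 1)) : ℝ) : ℂ) * (z * (z ^ k - (1 + k * (z - 1))))‖ ≤
        ‖z - 1‖ ^ 2 / 2 := by
      rw [norm_mul, norm_mul, hz, Complex.norm_real, Real.norm_of_nonneg (by
        have : (0 : ℝ) ≤ (k : ℝ) * (k - 1) := by apply mul_nonneg <;> linarith
        positivity)]
      rw [div_mul_eq_mul_div, div_le_iff₀ (by apply mul_pos <;> linarith)]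
      linarith
    rw [e, norm_mul, Complex.norm_real, Real.norm_of_nonneg (by positivity), div_mul_eq_mul_div,
      one_mul]
    apply div_le_div₀ (by positivity) _ (by norm_num) (by linarith)
    exact (norm_sub_le _ _).trans (by linarith)
  · obtain ⟨m, hm0⟩ := Int.eq_ofNat_of_zero_le (show 0 ≤ -n by omega)
    obtain rfl : n = -(m : ℤ) := by omega
    have hm : 3 ≤ m := by omega
    have hm' : (3 : ℝ) ≤ m := by exact_mod_cast hm
    have hw : ‖z⁻¹‖ = 1 := by rw [norm_inv, hz, inv_one]
    have hR := norm_pow_sub_interp03_le hw (m + 1) (by omega)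
    rw [norm_inv_sub_one hz] at hR
    have h1 : ((m : ℂ) + 1) ≠ 0 := by
      intro h; have : (m : ℝ) + 1 = 0 := by exact_mod_cast h
      linarith
    have h2 : ((m : ℂ) + 2) ≠ 0 := by
      intro h; have : (m : ℝ) + 2 = 0 := by exact_mod_cast h
      linarith
    have h3 : ((m : ℂ) - 2) ≠ 0 := by
      intro h; have : (m : ℝ) - 2 = 0 := by exact_mod_cast h
      linarith
    have e : dividedDiff (-(m : ℤ)) (fun p => z ^ p) =
        -((1 / ((m : ℝ) + 2) : ℝ) : ℂ) * (((1 / (((m : ℝ) + 1) * (m - 2)) : ℝ) : ℂ) * (z *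
        (z⁻¹ ^ (m + 1) - (1 + ((m + 1 : ℕ) : ℂ) / 3 * (z⁻¹ ^ 3 - 1)))) - secondDiff z) := by
      simp only [dividedDiff, Complex.real_smul, zpow_natCast, zpow_one, zpow_neg, secondDiff, inv_pow]
      rw [show (z ^ (2 : ℤ)) = z ^ 2 from zpow_natCast z 2]
      push_cast
      rw [show (-(m : ℂ) - 1) = -(m + 1) by ring, show (-(m : ℂ) - 2) = -(m + 2) by ring,
        show (-(m : ℂ) + 2) = -(m - 2) by ring]
      field_simp
      ring
    have hb : ‖((1 / (((m : ℝ) + 1) * (m - 2)) : ℝ) : ℂ) * (z *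
        (z⁻¹ ^ (m + 1) - (1 + ((m + 1 : ℕ) : ℂ) / 3 * (z⁻¹ ^ 3 - 1))))‖ ≤ ‖z - 1‖ ^ 2 / 2 := by
      rw [norm_mul, norm_mul, hz, Complex.norm_real, Real.norm_of_nonneg (by
        have : (0 : ℝ) ≤ ((m : ℝ) + 1) * (m - 2) := by apply mul_nonneg <;> linarith
        positivity)]
      rw [div_mul_eq_mul_div, div_le_iff₀ (by apply mul_pos <;> linarith)]
      push_cast at hR ⊢
      nlinarith
    rw [e, norm_mul, norm_neg, Complex.norm_real, Real.norm_of_nonneg (by positivity),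
      div_mul_eq_mul_div, one_mul]
    apply div_le_div₀ (by positivity) _ (by norm_num) (by linarith)
    exact (norm_sub_le _ _).trans (by linarith)

/-! ### The symbol of the second order operator on the unit circle -/

/-- The symbol `3/2 - 2 ζ + ζ² / 2` at `ζ = z⁻¹`. -/
def lubich (z : ℂ) : ℂ := 3 / 2 - 2 * z⁻¹ + z⁻¹ ^ 2 / 2

section Polynomials

variable {z : ℂ}

lemma ne_zero_of_norm_eq_one (hz : ‖z‖ = 1) : z ≠ 0 := by rintro rfl; simp at hz

lemma inv_eq_conj_of_norm_eq_one (hz : ‖z‖ = 1) : z⁻¹ = (starRingEnd ℂ) z :=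
  Complex.inv_eq_conj hz

lemma re_zpow_add_two (hz : ‖z‖ = 1) (k : ℤ) :
    (z ^ (k + 2)).re = 2 * z.re * (z ^ (k + 1)).re - (z ^ k).re := by
  have h0 := ne_zero_of_norm_eq_one hz
  have h : z + z⁻¹ = ((2 * z.re : ℝ) : ℂ) := by
    rw [inv_eq_conj_of_norm_eq_one hz, Complex.add_conj]
  have e : z ^ (k + 2) = ((2 * z.re : ℝ) : ℂ) * z ^ (k + 1) - z ^ k := by
    rw [← h, zpow_add₀ h0, zpow_add₀ h0]
    simp only [zpow_ofNat]
    field_simp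
    ring
  rw [e, Complex.sub_re, Complex.re_ofReal_mul]

lemma re_zpow_neg (hz : ‖z‖ = 1) (k : ℤ) : (z ^ (-k)).re = (z ^ k).re := by
  rw [zpow_neg, ← inv_zpow, inv_eq_conj_of_norm_eq_one hz, ← map_zpow₀, Complex.conj_re]

/-- These are Chebyshev polynomials in `1 - 2 σ`. Degree six suffices: `V ^ 2` lowers exponents by
at most four and the smallest explicit shift is `-2`. -/
lemma re_zpow_table (hz : ‖z‖ = 1) {σ : ℝ} (hσ : z.re = 1 - 2 * σ) :
    (z ^ (0 : ℤ)).re = 1 ∧ (z ^ (1 : ℤ)).re = 1 - 2 * σ ∧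
    (z ^ (2 : ℤ)).re = 1 - 8 * σ + 8 * σ ^ 2 ∧
    (z ^ (3 : ℤ)).re = 1 - 18 * σ + 48 * σ ^ 2 - 32 * σ ^ 3 ∧
    (z ^ (4 : ℤ)).re = 1 - 32 * σ + 160 * σ ^ 2 - 256 * σ ^ 3 + 128 * σ ^ 4 ∧
    (z ^ (5 : ℤ)).re = 1 - 50 * σ + 400 * σ ^ 2 - 1120 * σ ^ 3 + 1280 * σ ^ 4 - 512 * σ ^ 5 ∧
    (z ^ (6 : ℤ)).re = 1 - 72 * σ + 840 * σ ^ 2 - 3584 * σ ^ 3 + 6912 * σ ^ 4 - 6144 * σ ^ 5 +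
      2048 * σ ^ 6 := by
  have r0 : (z ^ (0 : ℤ)).re = 1 := by simp
  have r1 : (z ^ (1 : ℤ)).re = 1 - 2 * σ := by simpa using hσ
  have r2 := re_zpow_add_two hz 0
  have r3 := re_zpow_add_two hz 1
  have r4 := re_zpow_add_two hz 2
  have r5 := re_zpow_add_two hz 3
  have r6 := re_zpow_add_two hz 4
  norm_num only at r2 r3 r4 r5 r6
  rw [r1, r0, hσ] at r2
  rw [r2, r1, hσ] at r3
  rw [r3, r2, hσ] at r4
  rw [r4, r3, hσ] at r5
  rw [r5, r4, hσ] at r6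
  refine ⟨r0, r1, ?_, ?_, ?_, ?_, ?_⟩
  · rw [r2]; ring
  · rw [r3]; ring
  · rw [r4]; ring
  · rw [r5]; ring
  · rw [r6]; ring

lemma re_lubich_mul_zpow (hz : ‖z‖ = 1) (k : ℤ) :
    (lubich z * z ^ k).re =
      3 / 2 * (z ^ k).re - 2 * (z ^ (k - 1)).re + 1 / 2 * (z ^ (k - 2)).re := by
  have h0 := ne_zero_of_norm_eq_one hz
  have e : lubich z * z ^ k = ((3 / 2 : ℝ) : ℂ) * z ^ k - ((2 : ℝ) : ℂ) * z ^ (k - 1) +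
      ((1 / 2 : ℝ) : ℂ) * z ^ (k - 2) := by
    rw [zpow_sub₀ h0, zpow_sub₀ h0, lubich]
    simp only [zpow_ofNat]
    push_cast
    field_simp
  rw [e, Complex.add_re, Complex.sub_re, Complex.re_ofReal_mul, Complex.re_ofReal_mul,
    Complex.re_ofReal_mul]

lemma re_lubich_sq_mul_zpow (hz : ‖z‖ = 1) (k : ℤ) :
    (lubich z ^ 2 * z ^ k).re =
      9 / 4 * (z ^ k).re - 6 * (z ^ (k - 1)).re + 11 / 2 * (z ^ (k - 2)).re -
        2 * (z ^ (k - 3)).re + 1 / 4 * (z ^ (k - 4)).re := by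
  have h0 := ne_zero_of_norm_eq_one hz
  have e : lubich z ^ 2 * z ^ k = ((9 / 4 : ℝ) : ℂ) * z ^ k - ((6 : ℝ) : ℂ) * z ^ (k - 1) +
      ((11 / 2 : ℝ) : ℂ) * z ^ (k - 2) - ((2 : ℝ) : ℂ) * z ^ (k - 3) +
      ((1 / 4 : ℝ) : ℂ) * z ^ (k - 4) := by
    rw [zpow_sub₀ h0, zpow_sub₀ h0, zpow_sub₀ h0, zpow_sub₀ h0, lubich]
    simp only [zpow_ofNat]
    push_cast
    field_simp
    ring
  rw [e, Complex.add_re, Complex.sub_re, Complex.add_re, Complex.sub_re, Complex.re_ofReal_mul,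
    Complex.re_ofReal_mul, Complex.re_ofReal_mul, Complex.re_ofReal_mul, Complex.re_ofReal_mul]

lemma re_lubich_mul_table (hz : ‖z‖ = 1) {σ : ℝ} (hσ : z.re = 1 - 2 * σ) :
    (lubich z * z ^ (1 : ℤ)).re = -4 * σ ∧
    (lubich z * z ^ (2 : ℤ)).re = -8 * σ + 12 * σ ^ 2 ∧
    (lubich z * z ^ (-2 : ℤ)).re = 8 * σ - 4 * σ ^ 2 - 64 * σ ^ 3 + 64 * σ ^ 4 ∧
    (lubich z * z ^ (0 : ℤ)).re = 4 * σ ^ 2 ∧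
    (lubich z * z ^ (-1 : ℤ)).re = 4 * σ + 8 * σ ^ 2 - 16 * σ ^ 3 := by
  obtain ⟨r0, r1, r2, r3, r4, r5, r6⟩ := re_zpow_table hz hσ
  refine ⟨?_, ?_, ?_, ?_, ?_⟩ <;> rw [re_lubich_mul_zpow hz] <;> norm_num only <;>
    simp only [re_zpow_neg hz, r0, r1, r2, r3, r4] <;> ring

lemma re_lubich_sq_mul_table (hz : ‖z‖ = 1) {σ : ℝ} (hσ : z.re = 1 - 2 * σ) :
    (lubich z ^ 2 * z ^ (1 : ℤ)).re = -4 * σ - 4 * σ ^ 2 - 8 * σ ^ 3 ∧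
    (lubich z ^ 2 * z ^ (2 : ℤ)).re = -4 * σ + 20 * σ ^ 2 ∧
    (lubich z ^ 2 * z ^ (-2 : ℤ)).re =
      -4 * σ + 20 * σ ^ 2 + 128 * σ ^ 3 - 128 * σ ^ 4 - 512 * σ ^ 5 + 512 * σ ^ 6 ∧
    (lubich z ^ 2 * z ^ (0 : ℤ)).re = -4 * σ - 12 * σ ^ 2 + 32 * σ ^ 4 ∧
    (lubich z ^ 2 * z ^ (-1 : ℤ)).re =
      -4 * σ - 4 * σ ^ 2 + 56 * σ ^ 3 + 64 * σ ^ 4 - 128 * σ ^ 5 := by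
  obtain ⟨r0, r1, r2, r3, r4, r5, r6⟩ := re_zpow_table hz hσ
  refine ⟨?_, ?_, ?_, ?_, ?_⟩ <;> rw [re_lubich_sq_mul_zpow hz] <;> norm_num only <;>
    simp only [re_zpow_neg hz, r0, r1, r2, r3, r4, r5, r6] <;> ring

lemma normSq_eq_one (hz : ‖z‖ = 1) : z.re * z.re + z.im * z.im = 1 := by
  have := Complex.normSq_eq_norm_sq z
  rw [hz, Complex.normSq_apply] at this
  linarith

lemma norm_lubich_sq (hz : ‖z‖ = 1) {σ : ℝ} (hσ : z.re = 1 - 2 * σ) :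
    ‖lubich z‖ ^ 2 = 4 * σ * (1 + 3 * σ) := by
  have h := normSq_eq_one hz
  rw [← Complex.normSq_eq_norm_sq, lubich, inv_eq_conj_of_norm_eq_one hz, Complex.normSq_apply]
  simp [pow_two]
  rw [hσ] at h ⊢
  have h' : z.im * z.im = 4 * σ - 4 * σ ^ 2 := by linarith
  have h4 : z.im * z.im * (z.im * z.im) = (4 * σ - 4 * σ ^ 2) ^ 2 := by rw [h']; ring
  nlinarith

lemma norm_sub_one_sq (hz : ‖z‖ = 1) {σ : ℝ} (hσ : z.re = 1 - 2 * σ) :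
    ‖z - 1‖ ^ 2 = 4 * σ := by
  have h := normSq_eq_one hz
  rw [← Complex.normSq_eq_norm_sq, Complex.normSq_apply]
  simp
  rw [hσ] at h ⊢
  linarith

/-- The factor `3 + 2 z⁻¹ + z⁻²` has modulus at most `3` as soon as `σ` exceeds about `0.4701`; `12
/ 25` is a convenient value above it. -/
lemma norm_secondDiff_le (hz : ‖z‖ = 1) {σ : ℝ} (hσ : z.re = 1 - 2 * σ) (h0 : 12 / 25 ≤ σ)
    (h1 : σ ≤ 1) : ‖secondDiff z‖ ≤ σ := by
  have h := normSq_eq_one hz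
  have h2 := norm_sub_one_sq hz hσ
  have e : ‖3 + 2 * z⁻¹ + z⁻¹ ^ 2‖ ^ 2 = 8 + 16 * (1 - 2 * σ) + 12 * (1 - 2 * σ) ^ 2 := by
    rw [← Complex.normSq_eq_norm_sq, inv_eq_conj_of_norm_eq_one hz, Complex.normSq_apply]
    simp [pow_two]
    rw [hσ] at h ⊢
    have h' : z.im * z.im = 4 * σ - 4 * σ ^ 2 := by linarith
    have h4 : z.im * z.im * (z.im * z.im) = (4 * σ - 4 * σ ^ 2) ^ 2 := by rw [h']; ring
    nlinarith
  have b : ‖3 + 2 * z⁻¹ + z⁻¹ ^ 2‖ ≤ 3 := by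
    refine abs_le_of_sq_le_sq' ?_ (by norm_num) |>.2
    rw [e]; nlinarith
  rw [secondDiff, norm_div, norm_mul, norm_pow, h2, Complex.norm_ofNat]
  nlinarith

end Polynomials

/-- `Re ((ρ₁ V + ρ₂ V²) z ^ p)` with `V = lubich z`. -/
def realSymbol (ρ₁ ρ₂ : ℝ) (z : ℂ) (p : ℤ) : ℝ :=
  ρ₁ * (lubich z * z ^ p).re + ρ₂ * (lubich z ^ 2 * z ^ p).re

/-- Third order combination with shifts `1, 2, -2`, applied to a sequence. -/
def thirdOrder (α : ℝ) (φ : ℤ → ℝ) : ℝ :=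
  (4 / 3 - 2 * α / 9) * φ 1 + (α / 6 - 1 / 2) * φ 2 + (1 / 6 + α / 18) * φ (-2)

/-- Fourth order combination with shifts `1, 2, -2, n`, applied to a sequence. -/
def fourthOrder (α : ℝ) (n : ℤ) (φ : ℤ → ℝ) : ℝ :=
  -- The factor is `-errCoef α 2 (-2)`: the divided difference kills quadratics in the shift and so
  -- corrects only the leading error of the third order combination.
  thirdOrder α φ + (4 - 13 * α / 6) * dividedDiff n φ

lemma re_mul_dividedDiff (x z : ℂ) (n : ℤ) :
    (x * dividedDiff n (fun p => z ^ p)).re = dividedDiff n (fun p => (x * z ^ p).re) := by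
  simp only [dividedDiff, mul_add, mul_sub, Complex.add_re, Complex.sub_re, mul_smul_comm,
    Complex.smul_re]

lemma dividedDiff_realSymbol (ρ₁ ρ₂ : ℝ) (z : ℂ) (n : ℤ) :
    dividedDiff n (realSymbol ρ₁ ρ₂ z) =
      ρ₁ * dividedDiff n (fun p => (lubich z * z ^ p).re) +
        ρ₂ * dividedDiff n (fun p => (lubich z ^ 2 * z ^ p).re) := by
  simp only [dividedDiff, realSymbol, smul_eq_mul]; ring

/-! ### Scalar inequalities for the `V ^ 2` part when `|n| ≥ 3` -/

/-- The right side is `thirdOrder_lubich_sq` at `α = 1`, divided by `-σ`, and `11 / 6` is `4 - 13 α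
/ 6` there. The left side uses the bound `14 / 15 σ` for the divided difference, replaced by `3 / 5
σ` when `σ ≥ 12 / 25`. The lemmas named `two` are the case `α = 2`, where `4 - 13 α / 6 = -1 / 3`.
-/
lemma quintic_bound_small {s : ℝ} (h0 : 0 ≤ s) (h1 : s ≤ 12 / 25) :
    (11 / 6) * (56 / 15 * s * (1 + 3 * s)) ≤
      4 + 20 / 3 * s - 176 / 9 * s ^ 2 + 256 / 9 * s ^ 3 + 1024 / 9 * s ^ 4 * (1 - s) := by
  have h2 : 0 ≤ s ^ 4 * (1 - s) := by
    apply mul_nonneg (by positivity); linarith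
  nlinarith [mul_nonneg h0 (sub_nonneg.2 h1), mul_nonneg h0 (sq_nonneg (s - 12 / 25)),
    mul_nonneg h0 (sq_nonneg (s - 1 / 4)), sq_nonneg (s - 1 / 4), sq_nonneg (s - 12 / 25)]

lemma quintic_bound_large {s : ℝ} (h0 : 12 / 25 ≤ s) (h1 : s ≤ 1) :
    (11 / 6) * (12 / 5 * s * (1 + 3 * s)) ≤
      4 + 20 / 3 * s - 176 / 9 * s ^ 2 + 256 / 9 * s ^ 3 + 1024 / 9 * s ^ 4 * (1 - s) := by
  -- Using `s ≥ 12 / 25` twice lowers the quintic term to a cubic one.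
  have h4 : (12 / 25) * s ^ 3 * (1 - s) ≤ s ^ 4 * (1 - s) := by
    have : 0 ≤ s ^ 3 * (1 - s) := by apply mul_nonneg (by positivity); linarith
    nlinarith
  have h3 : (12 / 25) * s ^ 2 * (1 - s) ≤ s ^ 3 * (1 - s) := by
    have : 0 ≤ s ^ 2 * (1 - s) := by apply mul_nonneg (by positivity); linarith
    nlinarith
  nlinarith [mul_nonneg (sub_nonneg.2 h0) (sub_nonneg.2 h1),
    mul_nonneg (sub_nonneg.2 h0) (mul_nonneg (sub_nonneg.2 h0) (sub_nonneg.2 h1))]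

lemma quintic_bound_two_small {s : ℝ} (h0 : 0 ≤ s) (h1 : s ≤ 12 / 25) :
    (1 / 3) * (56 / 15 * s * (1 + 3 * s)) ≤
      4 + 4 / 3 * s - 256 / 9 * s ^ 2 + 320 / 9 * s ^ 3 + 1280 / 9 * s ^ 4 * (1 - s) := by
  have h2 : 0 ≤ s ^ 4 * (1 - s) := by
    apply mul_nonneg (by positivity); linarith
  nlinarith [mul_nonneg h0 (sub_nonneg.2 h1), mul_nonneg h0 (sq_nonneg (s - 12 / 25)),
    mul_nonneg h0 (sq_nonneg (s - 1 / 4)), sq_nonneg (s - 1 / 4), sq_nonneg (s - 12 / 25)]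

lemma quintic_bound_two_large {s : ℝ} (h0 : 12 / 25 ≤ s) (h1 : s ≤ 1) :
    (1 / 3) * (12 / 5 * s * (1 + 3 * s)) ≤
      4 + 4 / 3 * s - 256 / 9 * s ^ 2 + 320 / 9 * s ^ 3 + 1280 / 9 * s ^ 4 * (1 - s) := by
  have h4 : (12 / 25) * s ^ 3 * (1 - s) ≤ s ^ 4 * (1 - s) := by
    have : 0 ≤ s ^ 3 * (1 - s) := by apply mul_nonneg (by positivity); linarith
    nlinarith
  have h3 : (12 / 25) * s ^ 2 * (1 - s) ≤ s ^ 3 * (1 - s) := by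
    have : 0 ≤ s ^ 2 * (1 - s) := by apply mul_nonneg (by positivity); linarith
    nlinarith
  nlinarith [mul_nonneg (sub_nonneg.2 h0) (sub_nonneg.2 h1),
    mul_nonneg (sub_nonneg.2 h0) (mul_nonneg (sub_nonneg.2 h0) (sub_nonneg.2 h1))]

/-! ### Negativity of the symbols of the fourth order combinations -/

section Negativity

variable {z : ℂ}

lemma norm_sub_one_eq (hz : ‖z‖ = 1) {σ : ℝ} (hσ : z.re = 1 - 2 * σ) :
    ‖z - 1‖ = 2 * √σ := by
  have h := norm_sub_one_sq hz hσ
  rw [← Real.sqrt_sq (norm_nonneg (z - 1)), h, Real.sqrt_mul (by norm_num),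
    show (4 : ℝ) = 2 ^ 2 by norm_num, Real.sqrt_sq (by norm_num)]

lemma dividedDiff_zpow_bounds (hz : ‖z‖ = 1) {σ : ℝ} (hσ : z.re = 1 - 2 * σ) (h0 : 0 < σ)
    (h1 : σ < 1) {n : ℤ} (hn : 3 ≤ |n|) :
    ‖dividedDiff n (fun p => z ^ p)‖ * ‖lubich z‖ <
        6 / 11 * (σ ^ 2 * (44 / 9 + 128 / 9 * σ * (1 - σ))) ∧
      11 / 6 * (‖dividedDiff n (fun p => z ^ p)‖ * ‖lubich z‖ ^ 2) ≤
        σ * (4 + 20 / 3 * σ - 176 / 9 * σ ^ 2 + 256 / 9 * σ ^ 3 + 1024 / 9 * σ ^ 4 * (1 - σ)) ∧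
      1 / 3 * (‖dividedDiff n (fun p => z ^ p)‖ * ‖lubich z‖ ^ 2) ≤
        σ * (4 + 4 / 3 * σ - 256 / 9 * σ ^ 2 + 320 / 9 * σ ^ 3 +
          1280 / 9 * σ ^ 4 * (1 - σ)) := by
  set d := ‖dividedDiff n (fun p => z ^ p)‖
  have hd : 0 ≤ d := norm_nonneg _
  have hV := norm_lubich_sq hz hσ
  -- The window for the split point is narrow: `norm_secondDiff_le` needs `σ` above about `0.4701`,
  -- and the first estimate of the small case needs `σ < 31 / 64`.
  rcases le_or_gt σ (12 / 25) with h | h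
  · have hd1 : d ≤ 4 / 3 * (σ * √σ) := by
      have := norm_dividedDiff_zpow_le_cube hz hn
      rw [norm_sub_one_eq hz hσ] at this
      refine this.trans (le_of_eq ?_)
      have := Real.sq_sqrt h0.le
      linear_combination (8 / 6 * √σ) * this
    have hd2 : d ^ 2 ≤ 16 / 9 * σ ^ 3 := by
      calc d ^ 2 ≤ (4 / 3 * (σ * √σ)) ^ 2 := by gcongr
        _ = 16 / 9 * σ ^ 3 := by
          have := Real.sq_sqrt h0.le
          linear_combination (16 / 9 * σ ^ 2) * this
    have hd3 : d ≤ 14 / 15 * σ := by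
      have : √σ ≤ 7 / 10 := Real.sqrt_le_iff.mpr ⟨by norm_num, by linarith⟩
      nlinarith
    have hA : d * ‖lubich z‖ ^ 2 ≤ σ * (56 / 15 * σ * (1 + 3 * σ)) := by
      rw [hV]
      calc d * (4 * σ * (1 + 3 * σ)) ≤ 14 / 15 * σ * (4 * σ * (1 + 3 * σ)) := by gcongr
        _ = _ := by ring
    refine ⟨?_, ?_, ?_⟩
    -- This is `√(1 + 3 σ) ≤ 1 + 3 σ / 2`.
    · have : d * ‖lubich z‖ ≤ 8 / 3 * σ ^ 2 * (1 + 3 / 2 * σ) := by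
        refine (abs_le_of_sq_le_sq' ?_ (by positivity)).2
        rw [mul_pow, hV]
        calc d ^ 2 * (4 * σ * (1 + 3 * σ)) ≤ 16 / 9 * σ ^ 3 * (4 * σ * (1 + 3 * σ)) := by gcongr
          _ ≤ _ := by
            have : 0 ≤ σ ^ 6 := by positivity
            nlinarith
      refine this.trans_lt ?_
      have : 0 < σ ^ 3 := by positivity
      nlinarith
    · nlinarith [mul_le_mul_of_nonneg_left (quintic_bound_small h0.le h) h0.le]
    · nlinarith [mul_le_mul_of_nonneg_left (quintic_bound_two_small h0.le h) h0.le]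
  · have hd1 : d ≤ 3 / 5 * σ := by
      have := norm_dividedDiff_zpow_le_sq hz hn
      rw [norm_sub_one_sq hz hσ] at this
      have := norm_secondDiff_le hz hσ h.le h1.le
      linarith
    have hA : d * ‖lubich z‖ ^ 2 ≤ σ * (12 / 5 * σ * (1 + 3 * σ)) := by
      rw [hV]
      calc d * (4 * σ * (1 + 3 * σ)) ≤ 3 / 5 * σ * (4 * σ * (1 + 3 * σ)) := by gcongr
        _ = _ := by ring
    refine ⟨?_, ?_, ?_⟩
    · have h2 : 0 ≤ σ * (1 - σ) := mul_nonneg h0.le (by linarith)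
      refine (abs_lt_of_sq_lt_sq' ?_ (by nlinarith [sq_nonneg σ, mul_nonneg (sq_nonneg σ) h2])).2
      have h3 : 36 / 25 * (1 + 3 * σ) < σ * (8 / 3 + 256 / 33 * (σ * (1 - σ))) ^ 2 := by
        -- The square is cut after its linear term, whose exact coefficient is `4096 / 99 > 41`.
        have : 64 / 9 + 41 * (σ * (1 - σ)) ≤ (8 / 3 + 256 / 33 * (σ * (1 - σ))) ^ 2 := by
          nlinarith [sq_nonneg (σ * (1 - σ))]
        nlinarith [mul_le_mul_of_nonneg_left this h0.le]
      calc (d * ‖lubich z‖) ^ 2 = d ^ 2 * (4 * σ * (1 + 3 * σ)) := by rw [mul_pow, hV]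
        _ ≤ (3 / 5 * σ) ^ 2 * (4 * σ * (1 + 3 * σ)) := by gcongr
        _ = σ ^ 3 * (36 / 25 * (1 + 3 * σ)) := by ring
        _ < σ ^ 3 * (σ * (8 / 3 + 256 / 33 * (σ * (1 - σ))) ^ 2) := by gcongr
        _ = _ := by ring
    · nlinarith [mul_le_mul_of_nonneg_left (quintic_bound_large h.le h1.le) h0.le]
    · nlinarith [mul_le_mul_of_nonneg_left (quintic_bound_two_large h.le h1.le) h0.le]

lemma thirdOrder_lubich (hz : ‖z‖ = 1) {σ : ℝ} (hσ : z.re = 1 - 2 * σ) (α : ℝ) :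
    thirdOrder α (fun p => (lubich z * z ^ p).re) =
      -σ ^ 2 * (20 / 3 - 16 / 9 * α + (32 / 3 + 32 / 9 * α) * σ * (1 - σ)) := by
  obtain ⟨h1, h2, h3, -, -⟩ := re_lubich_mul_table hz hσ
  simp only [thirdOrder, h1, h2, h3]
  ring

lemma thirdOrder_lubich_sq (hz : ‖z‖ = 1) {σ : ℝ} (hσ : z.re = 1 - 2 * σ) (α : ℝ) :
    thirdOrder α (fun p => (lubich z ^ 2 * z ^ p).re) =
      -σ * (4 + (12 - 16 / 3 * α) * σ - (32 / 3 + 80 / 9 * α) * σ ^ 2 +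
        (64 / 3 + 64 / 9 * α) * σ ^ 3 + (256 / 3 + 256 / 9 * α) * σ ^ 4 * (1 - σ)) := by
  obtain ⟨h1, h2, h3, -, -⟩ := re_lubich_sq_mul_table hz hσ
  simp only [thirdOrder, h1, h2, h3]
  ring

lemma fourthOrder_realSymbol (ρ₁ ρ₂ : ℝ) (z : ℂ) (α : ℝ) (n : ℤ) :
    fourthOrder α n (realSymbol ρ₁ ρ₂ z) =
      ρ₁ * fourthOrder α n (fun p => (lubich z * z ^ p).re) +
        ρ₂ * fourthOrder α n (fun p => (lubich z ^ 2 * z ^ p).re) := by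
  simp only [fourthOrder, thirdOrder, dividedDiff_realSymbol]
  simp only [realSymbol]
  ring

/-- Both expressions are affine in `α`, so each is `(2 - α)` times its value at `α = 1` plus `(α -
1)` times its value at `α = 2`. The inequalities `e1` and `e2` treat these two endpoints. -/
lemma fourthOrder_neg_of_three_le (hz : ‖z‖ = 1) {σ : ℝ} (hσ : z.re = 1 - 2 * σ) (hσ0 : 0 < σ)
    (hσ1 : σ < 1) {α : ℝ} (hα : 1 < α) (hα' : α < 2) {n : ℤ} (hn : 3 ≤ |n|) :
    fourthOrder α n (fun p => (lubich z * z ^ p).re) < 0 ∧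
      fourthOrder α n (fun p => (lubich z ^ 2 * z ^ p).re) ≤ 0 := by
  have hb : 0 ≤ σ * (1 - σ) := mul_nonneg hσ0.le (by linarith)
  obtain ⟨b1, b2, b3⟩ := dividedDiff_zpow_bounds hz hσ hσ0 hσ1 hn
  have hX := abs_le.mp ((Complex.abs_re_le_norm _).trans
    (norm_mul (lubich z) (dividedDiff n (fun p => z ^ p))).le)
  have hY := abs_le.mp ((Complex.abs_re_le_norm _).trans
    (norm_mul (lubich z ^ 2) (dividedDiff n (fun p => z ^ p))).le)
  rw [re_mul_dividedDiff, mul_comm ‖lubich z‖] at hX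
  rw [re_mul_dividedDiff, norm_pow, mul_comm (‖lubich z‖ ^ 2)] at hY
  rw [fourthOrder, fourthOrder, thirdOrder_lubich hz hσ, thirdOrder_lubich_sq hz hσ]
  set X := dividedDiff n (fun p => (lubich z * z ^ p).re)
  set Y := dividedDiff n (fun p => (lubich z ^ 2 * z ^ p).re)
  set dV := ‖dividedDiff n (fun p => z ^ p)‖ * ‖lubich z‖
  set dV2 := ‖dividedDiff n (fun p => z ^ p)‖ * ‖lubich z‖ ^ 2
  have hs2 : 0 < σ ^ 2 := by positivity
  constructor
  · have e1 : -σ ^ 2 * (44 / 9 + 128 / 9 * σ * (1 - σ)) + 11 / 6 * X < 0 := by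
      linarith [hX.2]
    have e2 : -σ ^ 2 * (28 / 9 + 160 / 9 * σ * (1 - σ)) - 1 / 3 * X < 0 := by
      nlinarith [hX.1, mul_nonneg hs2.le hb]
    have e3 := mul_neg_of_pos_of_neg (sub_pos.2 hα') e1
    have e4 := mul_neg_of_pos_of_neg (sub_pos.2 hα) e2
    linarith
  · have e1 : -(σ * (4 + 20 / 3 * σ - 176 / 9 * σ ^ 2 + 256 / 9 * σ ^ 3 +
        1024 / 9 * σ ^ 4 * (1 - σ))) + 11 / 6 * Y ≤ 0 := by
      linarith [hY.2]
    have e2 : -(σ * (4 + 4 / 3 * σ - 256 / 9 * σ ^ 2 + 320 / 9 * σ ^ 3 +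
        1280 / 9 * σ ^ 4 * (1 - σ))) - 1 / 3 * Y ≤ 0 := by
      linarith [hY.1]
    have e3 := mul_nonpos_of_nonneg_of_nonpos (sub_pos.2 hα').le e1
    have e4 := mul_nonpos_of_nonneg_of_nonpos (sub_pos.2 hα).le e2
    linarith

/-- For `n = 0` the divided difference is explicit. In the `V ^ 2` part `e1` and `e2` are again the
endpoints `α = 1, 2`, up to multiples of `σ ^ 4 * (1 - σ)`, which have a good sign. -/
lemma fourthOrder_neg_zero (hz : ‖z‖ = 1) {σ : ℝ} (hσ : z.re = 1 - 2 * σ) (hσ0 : 0 < σ)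
    (hσ1 : σ < 1) {α : ℝ} (hα : 1 < α) (hα' : α < 2) :
    fourthOrder α 0 (fun p => (lubich z * z ^ p).re) < 0 ∧
      fourthOrder α 0 (fun p => (lubich z ^ 2 * z ^ p).re) ≤ 0 := by
  have hb : 0 ≤ σ * (1 - σ) := mul_nonneg hσ0.le (by linarith)
  obtain ⟨p1, p2, p3, p4, p5⟩ := re_lubich_mul_table hz hσ
  obtain ⟨q1, q2, q3, q4, q5⟩ := re_lubich_sq_mul_table hz hσ
  simp only [fourthOrder, thirdOrder, dividedDiff, p1, p2, p3, p4, q1, q2, q3, q4,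
    smul_eq_mul]
  norm_num
  constructor
  · have : -σ ^ 2 * (4 * (α - 1) + 28 / 3 * α * (σ * (1 - σ))) < 0 := by
      have : 0 ≤ α * (σ * (1 - σ)) := mul_nonneg (by linarith) hb
      nlinarith [sq_nonneg σ, mul_pos hσ0 hσ0]
    linarith
  · have h4 : 0 ≤ σ ^ 4 * (1 - σ) := mul_nonneg (by positivity) (by linarith)
    have e1 : 0 ≤ 4 + 20 / 3 * σ - 44 / 3 * σ ^ 2 + 4 * σ ^ 3 := by
      nlinarith [mul_nonneg (sub_nonneg.2 hσ1.le) (mul_nonneg hσ0.le (sub_nonneg.2 hσ1.le))]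
    have e2 : 0 ≤ 4 + 4 / 3 * σ - 88 / 3 * σ ^ 2 + 40 * σ ^ 3 := by
      nlinarith [mul_nonneg hσ0.le (sq_nonneg (σ - 1 / 2)), sq_nonneg (σ - 1 / 2)]
    have e3 := mul_nonneg hσ0.le (mul_nonneg (sub_pos.2 hα').le e1)
    have e4 := mul_nonneg hσ0.le (mul_nonneg (sub_pos.2 hα).le e2)
    have e5 := mul_nonneg hσ0.le (mul_nonneg (by linarith : 0 ≤ α) h4)
    linarith

lemma fourthOrder_neg_neg_one (hz : ‖z‖ = 1) {σ : ℝ} (hσ : z.re = 1 - 2 * σ) (hσ0 : 0 < σ)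
    (hσ1 : σ < 1) {α : ℝ} (hα : 1 < α) (hα' : α < 2) :
    fourthOrder α (-1) (fun p => (lubich z * z ^ p).re) < 0 ∧
      fourthOrder α (-1) (fun p => (lubich z ^ 2 * z ^ p).re) ≤ 0 := by
  obtain ⟨p1, p2, p3, p4, p5⟩ := re_lubich_mul_table hz hσ
  obtain ⟨q1, q2, q3, q4, q5⟩ := re_lubich_sq_mul_table hz hσ
  simp only [fourthOrder, thirdOrder, dividedDiff, p1, p2, p3, p5, q1, q2, q3, q5,
    smul_eq_mul]
  norm_num
  constructor
  · have e1 : 0 < 28 / 3 * σ - 40 / 9 * σ ^ 2 := by nlinarith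
    have e2 : 0 < 4 + 56 / 3 * σ - 176 / 9 * σ ^ 2 := by nlinarith
    have e3 := mul_pos (mul_pos hσ0 hσ0) (mul_pos (sub_pos.2 hα') e1)
    have e4 := mul_pos (mul_pos hσ0 hσ0) (mul_pos (sub_pos.2 hα) e2)
    linarith
  · have h4 : 0 ≤ σ ^ 4 * (1 - σ) := mul_nonneg (by positivity) (by linarith)
    have e1 : 0 ≤ 4 + 20 / 3 * σ - 176 / 9 * σ ^ 2 - 32 / 3 * σ ^ 3 + 352 / 9 * σ ^ 4 := by
      nlinarith [mul_nonneg hσ0.le (sq_nonneg (σ - 1 / 2)), sq_nonneg (σ - 1 / 2),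
        sq_nonneg (σ ^ 2 - 2 / 5), sq_nonneg (σ ^ 2 - σ)]
    have e2 : 0 ≤ 4 + 4 / 3 * σ - 256 / 9 * σ ^ 2 + 128 / 3 * σ ^ 3 - 64 / 9 * σ ^ 4 := by
      nlinarith [mul_nonneg hσ0.le (sq_nonneg (σ - 1 / 2)), sq_nonneg (σ - 1 / 2),
        mul_nonneg (pow_nonneg hσ0.le 3) (sub_nonneg.2 hσ1.le)]
    have e3 := mul_nonneg hσ0.le (mul_nonneg (sub_pos.2 hα').le e1)
    have e4 := mul_nonneg hσ0.le (mul_nonneg (sub_pos.2 hα).le e2)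
    have e5 := mul_nonneg hσ0.le (mul_nonneg (sub_pos.2 hα').le h4)
    have e6 := mul_nonneg hσ0.le (mul_nonneg (sub_pos.2 hα).le h4)
    linarith

lemma exists_re_eq (hz : ‖z‖ = 1) (him : z.im ≠ 0) :
    ∃ σ, z.re = 1 - 2 * σ ∧ 0 < σ ∧ σ < 1 := by
  have hσ : z.re = 1 - 2 * ((1 - z.re) / 2) := by ring
  have hn1 := normSq_eq_one hz
  have him2 : 0 < z.im * z.im := mul_self_pos.2 him
  exact ⟨(1 - z.re) / 2, hσ, by nlinarith, by nlinarith⟩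

/-- The fourth order combinations with shifts `1, 2, -2, n` for `|n| ≥ 3`, `n = 0`, `n = -1`. -/
theorem fourthOrder_realSymbol_neg (hz : ‖z‖ = 1) (him : z.im ≠ 0) {α : ℝ} (hα : 1 < α)
    (hα' : α < 2) {ρ₁ ρ₂ : ℝ} (h₁ : 0 < ρ₁) (h₂ : 0 < ρ₂) {n : ℤ}
    (hn : 3 ≤ |n| ∨ n = 0 ∨ n = -1) :
    fourthOrder α n (realSymbol ρ₁ ρ₂ z) < 0 := by
  obtain ⟨σ, hσ, hσ0, hσ1⟩ := exists_re_eq hz him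
  rw [fourthOrder_realSymbol]
  suffices H : fourthOrder α n (fun p => (lubich z * z ^ p).re) < 0 ∧
      fourthOrder α n (fun p => (lubich z ^ 2 * z ^ p).re) ≤ 0 by
    nlinarith [H.1, H.2]
  rcases hn with hn | rfl | rfl
  · exact fourthOrder_neg_of_three_le hz hσ hσ0 hσ1 hα hα' hn
  · exact fourthOrder_neg_zero hz hσ hσ0 hσ1 hα hα'
  · exact fourthOrder_neg_neg_one hz hσ hσ0 hσ1 hα hα'

end Negativity

/-! ### The fourth order combination of a family of vectors indexed by the shifts -/

section Stencil

variable {E : Type*} [AddCommGroup E] [Module ℝ E]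

/-- Second order combination of the family `φ`. -/
def stencil2 (p q : ℤ) (φ : ℤ → E) : E :=
  ((q : ℝ) / ((q : ℝ) - p)) • φ p + ((p : ℝ) / ((p : ℝ) - q)) • φ q

/-- Third order combination of the family `φ`. -/
def stencil3 (α : ℝ) (p q r s : ℤ) (φ : ℤ → E) : E :=
  ((3 * (r : ℝ) * s + 2 * α) / (3 * ((r : ℝ) * s - (p : ℝ) * q))) • stencil2 p q φ +
    ((3 * (p : ℝ) * q + 2 * α) / (3 * ((p : ℝ) * q - (r : ℝ) * s))) • stencil2 r s φ

/-- Fourth order combination of the family `φ`. -/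
def stencil4 (α : ℝ) (S : Shifts) (φ : ℤ → E) : E :=
  (S.ab' α / (S.ab' α - S.a'b α)) • stencil3 α S.p S.q S.r S.s φ +
    (S.a'b α / (S.a'b α - S.ab' α)) • stencil3 α S.p' S.q' S.r' S.s' φ

/-- Stencils act on matrices, continuous functions and numbers alike; this carries them through the
quadratic form, the integral and point evaluation. -/
lemma map_stencil4 {F : Type*} [AddCommGroup F] [Module ℝ F] (f : E →ₗ[ℝ] F) (α : ℝ)
    (S : Shifts) (φ : ℤ → E) : f (stencil4 α S φ) = stencil4 α S (fun p => f (φ p)) := by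
  simp only [stencil4, stencil3, stencil2, map_add, map_smul]

end Stencil

/-- The error coefficient `b / (6 a)` of the third order combination with shifts `1, q, s`. -/
def errCoef (α q s : ℝ) : ℝ := q * s + 2 * α / 3 * (1 + q + s) + 3 * α / 2

lemma coefB_one (α q s : ℝ) : coefB α 1 q 1 s = 6 * (s - q) * errCoef α q s := by
  simp only [coefB, errCoef]; ring

/-- With first shift `1` the factors `6 (s - q)` cancel, and the weights become those for which the
two values of `errCoef` average to zero. -/
lemma stencil4_one (α : ℝ) {q s q' s' : ℤ} (h : (s : ℝ) - q ≠ 0) (h' : (s' : ℝ) - q' ≠ 0)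
    (φ : ℤ → ℝ) :
    stencil4 α ⟨1, q, 1, s, 1, q', 1, s'⟩ φ =
      errCoef α q' s' / (errCoef α q' s' - errCoef α q s) * stencil3 α 1 q 1 s φ +
        errCoef α q s / (errCoef α q s - errCoef α q' s') * stencil3 α 1 q' 1 s' φ := by
  simp only [stencil4, Shifts.ab', Shifts.a'b, Int.cast_one, coefB_one, coefA, smul_eq_mul,
    one_mul]
  have h6 : 6 * ((s : ℝ) - q) * (s' - q') ≠ 0 := by positivity
  congr 2
  · rw [← mul_div_mul_left _ (errCoef α q' s' - errCoef α q s) h6]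
    congr 1 <;> ring
  · rw [← mul_div_mul_left _ (errCoef α q s - errCoef α q' s') h6]
    congr 1 <;> ring

lemma nondegenerate_one {α : ℝ} {q s q' s' : ℤ}
    (h : Shifts.Nondegenerate ⟨1, q, 1, s, 1, q', 1, s'⟩ α) :
    errCoef α q' s' - errCoef α q s ≠ 0 := by
  intro h0
  apply h
  simp only [Shifts.ab', Shifts.a'b, Int.cast_one, coefB_one, coefA]
  linear_combination (6 * ((s : ℝ) - q) * (s' - q')) * h0

/-- The combination with shifts `1, 2, -2, k, s` is a multiple of a convex combination of those
with shifts `1, 2, -2, k` and `1, 2, -2, s`. -/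
lemma stencil4_family {α : ℝ} {k s : ℤ} (hk : 3 ≤ k) (hs : s ≤ -3)
    (hΔ : errCoef α k s - errCoef α 2 (-2) ≠ 0) (φ : ℤ → ℝ) :
    (k - s) * (errCoef α 2 (-2) - errCoef α k s) * stencil4 α ⟨1, 2, 1, -2, 1, k, 1, s⟩ φ =
      (-s - 2 * α / 3) * (k ^ 2 - 4) * fourthOrder α k φ +
        (2 * α / 3 + k) * (s ^ 2 - 4) * fourthOrder α s φ := by
  have hk' : (3 : ℝ) ≤ k := by exact_mod_cast hk
  have hs' : (s : ℝ) ≤ -3 := by exact_mod_cast hs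
  have h1 : (s : ℝ) - k ≠ 0 := by intro h; linarith
  have h1' : (k : ℝ) - s ≠ 0 := by intro h; linarith
  have h2 : (k : ℝ) - 1 ≠ 0 := by intro h; linarith
  have h2' : 1 - (k : ℝ) ≠ 0 := by intro h; linarith
  have h3 : (s : ℝ) - 1 ≠ 0 := by intro h; linarith
  have h3' : 1 - (s : ℝ) ≠ 0 := by intro h; linarith
  have h4 : (k : ℝ) - 2 ≠ 0 := by intro h; linarith
  have h5 : (s : ℝ) - 2 ≠ 0 := by intro h; linarith
  have h6 : (k : ℝ) + 2 ≠ 0 := by intro h; linarith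
  have h7 : (s : ℝ) + 2 ≠ 0 := by intro h; linarith
  rw [stencil4_one α (by norm_num) h1]
  push_cast
  have hE : errCoef α k s = errCoef α 2 (-2) + (errCoef α k s - errCoef α 2 (-2)) := by ring
  have e : (k - s) * (errCoef α 2 (-2) - errCoef α k s) *
      (errCoef α k s / (errCoef α k s - errCoef α 2 (-2)) * stencil3 α 1 2 1 (-2) φ +
        errCoef α 2 (-2) / (errCoef α 2 (-2) - errCoef α k s) * stencil3 α 1 k 1 s φ) =
      (k - s) * (-errCoef α k s * stencil3 α 1 2 1 (-2) φ +
        errCoef α 2 (-2) * stencil3 α 1 k 1 s φ) := by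
    have hΔ' : errCoef α 2 (-2) - errCoef α k s ≠ 0 := by
      intro h; apply hΔ; linarith
    field_simp
    ring
  rw [e]
  simp only [stencil3, stencil2, fourthOrder, thirdOrder, dividedDiff, errCoef, smul_eq_mul]
  push_cast
  generalize φ 1 = a
  generalize φ 2 = b
  generalize φ (-2) = c
  generalize φ k = d
  generalize φ s = f
  generalize (k : ℝ) = k at *
  generalize (s : ℝ) = s at *
  field_simp
  ring

/-- Four distinct shifts leave no freedom in a fourth order combination, so the result must be
`fourthOrder`. The same holds for every other identity below whose right side is a single
`fourthOrder`. -/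
lemma stencil4_family_two {α : ℝ} (hα : 0 < α) {s : ℤ} (hs : s ≤ -3) (φ : ℤ → ℝ) :
    stencil4 α ⟨1, 2, 1, -2, 1, 2, 1, s⟩ φ = fourthOrder α s φ := by
  have hs' : (s : ℝ) ≤ -3 := by exact_mod_cast hs
  have h1 : (s : ℝ) - 2 ≠ 0 := by intro h; linarith
  have h3 : (s : ℝ) - 1 ≠ 0 := by intro h; linarith
  have h3' : 1 - (s : ℝ) ≠ 0 := by intro h; linarith
  have h1' : 2 - (s : ℝ) ≠ 0 := by intro h; linarith
  have h7 : (s : ℝ) + 2 ≠ 0 := by intro h; linarith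
  have h8 : 3 + α ≠ 0 := by positivity
  rw [stencil4_one α (by norm_num) (by exact_mod_cast h1)]
  have hΔ : errCoef α (2 : ℤ) s - errCoef α (2 : ℤ) (-2 : ℤ) =
      2 / 3 * ((s : ℝ) + 2) * (3 + α) := by
    simp only [errCoef]; push_cast; ring
  rw [← neg_sub (errCoef α (2 : ℤ) s), hΔ]
  simp only [stencil3, stencil2, fourthOrder, thirdOrder, dividedDiff, errCoef, smul_eq_mul]
  push_cast
  generalize φ 1 = a
  generalize φ 2 = b
  generalize φ (-2) = c
  generalize φ s = f
  generalize (s : ℝ) = s at *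
  field_simp
  ring

lemma stencil4_family_neg_two {α : ℝ} (hα : α < 3) {k : ℤ} (hk : 3 ≤ k) (φ : ℤ → ℝ) :
    stencil4 α ⟨1, 2, 1, -2, 1, k, 1, -2⟩ φ = fourthOrder α k φ := by
  have hk' : (3 : ℝ) ≤ k := by exact_mod_cast hk
  have h1 : -2 - (k : ℝ) ≠ 0 := by intro h; linarith
  have h3 : (k : ℝ) - 1 ≠ 0 := by intro h; linarith
  have h3' : 1 - (k : ℝ) ≠ 0 := by intro h; linarith
  have h1' : (k : ℝ) - 2 ≠ 0 := by intro h; linarith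
  have h7 : (k : ℝ) + 2 ≠ 0 := by intro h; linarith
  have h8 : 3 - α ≠ 0 := by intro h; linarith
  rw [stencil4_one α (by norm_num) (by exact_mod_cast h1)]
  have hΔ : errCoef α k (-2 : ℤ) - errCoef α (2 : ℤ) (-2 : ℤ) =
      -(2 / 3 * ((k : ℝ) - 2) * (3 - α)) := by
    simp only [errCoef]; push_cast; ring
  rw [← neg_sub (errCoef α k (-2 : ℤ)), hΔ]
  simp only [stencil3, stencil2, fourthOrder, thirdOrder, dividedDiff, errCoef, smul_eq_mul]
  push_cast
  generalize φ 1 = a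
  generalize φ 2 = b
  generalize φ (-2) = c
  generalize φ k = f
  generalize (k : ℝ) = k at *
  rw [show 1 * -2 - 1 * k = -(k + 2) by ring, show 1 * k - 1 * -2 = k + 2 by ring]
  field_simp
  ring

lemma stencil4_swap (α : ℝ) {q s q' s' : ℤ} (h : (s : ℝ) - q ≠ 0) (h' : (s' : ℝ) - q' ≠ 0)
    (φ : ℤ → ℝ) :
    stencil4 α ⟨1, q, 1, s, 1, q', 1, s'⟩ φ = stencil4 α ⟨1, q, 1, s, 1, s', 1, q'⟩ φ := by
  have h2 : (q' : ℝ) - s' ≠ 0 := by intro h; apply h'; linarith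
  have e : errCoef α s' q' = errCoef α q' s' := by simp only [errCoef]; ring
  rw [stencil4_one α h h', stencil4_one α h h2, e]
  congr 2
  simp only [stencil3, Int.cast_one]
  rw [add_comm]

/-! ### Stencils of the seven isolated shift choices -/

section Exceptional

variable {α : ℝ} (φ : ℤ → ℝ)

lemma stencil4_two_zero_two_neg_two (hα : 0 < α) :
    stencil4 α ⟨1, 2, 1, 0, 1, 2, 1, -2⟩ φ = fourthOrder α 0 φ := by
  rw [stencil4_one α (by norm_num) (by norm_num)]
  have h1 : errCoef α (2 : ℤ) (-2 : ℤ) - errCoef α (2 : ℤ) (0 : ℤ) = -(4 / 3 * (3 + α)) := by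
    simp only [errCoef]; push_cast; ring
  have h2 : 3 + α ≠ 0 := by positivity
  rw [← neg_sub (errCoef α (2 : ℤ) (-2 : ℤ)), h1]
  simp only [stencil3, stencil2, fourthOrder, thirdOrder, dividedDiff, errCoef, smul_eq_mul]
  push_cast
  field_simp
  ring

lemma stencil4_two_neg_one_two_neg_two (hα : 0 < α) :
    stencil4 α ⟨1, 2, 1, -1, 1, 2, 1, -2⟩ φ = fourthOrder α (-1) φ := by
  rw [stencil4_one α (by norm_num) (by norm_num)]
  have h1 : errCoef α (2 : ℤ) (-2 : ℤ) - errCoef α (2 : ℤ) (-1 : ℤ) = -(2 / 3 * (3 + α)) := by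
    simp only [errCoef]; push_cast; ring
  have h2 : 3 + α ≠ 0 := by positivity
  rw [← neg_sub (errCoef α (2 : ℤ) (-2 : ℤ)), h1]
  simp only [stencil3, stencil2, fourthOrder, thirdOrder, dividedDiff, errCoef, smul_eq_mul]
  push_cast
  field_simp
  ring

lemma stencil4_two_neg_one_neg_one_neg_two (hα : 3 - 2 * α ≠ 0) :
    stencil4 α ⟨1, 2, 1, -1, 1, -1, 1, -2⟩ φ = fourthOrder α (-1) φ := by
  rw [stencil4_one α (by norm_num) (by norm_num)]
  have h1 : errCoef α (-1 : ℤ) (-2 : ℤ) - errCoef α (2 : ℤ) (-1 : ℤ) = 4 / 3 * (3 - 2 * α) := by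
    simp only [errCoef]; push_cast; ring
  have h2 : 3 - 2 * α ≠ 0 := hα
  rw [← neg_sub (errCoef α (-1 : ℤ) (-2 : ℤ)), h1]
  simp only [stencil3, stencil2, fourthOrder, thirdOrder, dividedDiff, errCoef, smul_eq_mul]
  push_cast
  field_simp
  ring

lemma stencil4_zero_neg_two_two_neg_two (hα : α < 3) :
    stencil4 α ⟨1, 0, 1, -2, 1, 2, 1, -2⟩ φ = fourthOrder α 0 φ := by
  rw [stencil4_one α (by norm_num) (by norm_num)]
  have h1 : errCoef α (2 : ℤ) (-2 : ℤ) - errCoef α (0 : ℤ) (-2 : ℤ) = -(4 / 3 * (3 - α)) := by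
    simp only [errCoef]; push_cast; ring
  have h2 : 3 - α ≠ 0 := by intro h; linarith
  rw [← neg_sub (errCoef α (2 : ℤ) (-2 : ℤ)), h1]
  simp only [stencil3, stencil2, fourthOrder, thirdOrder, dividedDiff, errCoef, smul_eq_mul]
  push_cast
  field_simp
  ring

lemma stencil4_neg_one_neg_two_two_neg_two (hα : α < 3) :
    stencil4 α ⟨1, -1, 1, -2, 1, 2, 1, -2⟩ φ = fourthOrder α (-1) φ := by
  rw [stencil4_one α (by norm_num) (by norm_num)]
  have h1 : errCoef α (2 : ℤ) (-2 : ℤ) - errCoef α (-1 : ℤ) (-2 : ℤ) = -(2 * (3 - α)) := by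
    simp only [errCoef]; push_cast; ring
  have h2 : 3 - α ≠ 0 := by intro h; linarith
  rw [← neg_sub (errCoef α (2 : ℤ) (-2 : ℤ)), h1]
  simp only [stencil3, stencil2, fourthOrder, thirdOrder, dividedDiff, errCoef, smul_eq_mul]
  push_cast
  field_simp
  ring

/-- Here all of `1, 2, 0, -1, -2` occur, so no single `fourthOrder` is available; the prefactor
clears the `α`-dependent denominator of the weights. The next lemma is of the same kind. -/
lemma stencil4_two_zero_neg_one_neg_two (hα : 1 < α) :
    2 * (5 * α - 3) * stencil4 α ⟨1, 2, 1, 0, 1, -1, 1, -2⟩ φ =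
      3 * ((5 / 2 * α + 1 / 2 * α ^ 2) * φ 1 + (7 / 2 * α - 7 / 6 * α ^ 2) * φ (-1) +
        (-7 / 6 * α + 7 / 9 * α ^ 2) * φ (-2) + (-2 / 3 * α - 1 / 18 * α ^ 2) * φ 2 +
        (-2 - 5 / 6 * α - 1 / 18 * α ^ 2) * φ 0) := by
  rw [stencil4_one α (by norm_num) (by norm_num)]
  have h1 : errCoef α (-1 : ℤ) (-2 : ℤ) - errCoef α (2 : ℤ) (0 : ℤ) =
      -(2 / 3 * (5 * α - 3)) := by
    simp only [errCoef]; push_cast; ring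
  have h2 : 5 * α - 3 ≠ 0 := by intro h; linarith
  rw [← neg_sub (errCoef α (-1 : ℤ) (-2 : ℤ)), h1]
  simp only [stencil3, stencil2, errCoef, smul_eq_mul]
  push_cast
  field_simp
  ring

lemma stencil4_zero_neg_one_two_neg_two (hα : α < 2) :
    2 * (6 - α) * stencil4 α ⟨1, 0, 1, -1, 1, 2, 1, -2⟩ φ =
      3 * ((10 / 3 * α - 19 / 18 * α ^ 2) * φ 1 + (-3 / 4 * α + 1 / 4 * α ^ 2) * φ 2 +
        (1 / 4 * α + 1 / 12 * α ^ 2) * φ (-2) + (4 - 29 / 6 * α + 13 / 9 * α ^ 2) * φ 0 +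
        (4 / 3 * α - 13 / 18 * α ^ 2) * φ (-1)) := by
  rw [stencil4_one α (by norm_num) (by norm_num)]
  have h1 : errCoef α (2 : ℤ) (-2 : ℤ) - errCoef α (0 : ℤ) (-1 : ℤ) =
      -(2 / 3 * (6 - α)) := by
    simp only [errCoef]; push_cast; ring
  have h2 : 6 - α ≠ 0 := by intro h; linarith
  rw [← neg_sub (errCoef α (2 : ℤ) (-2 : ℤ)), h1]
  simp only [stencil3, stencil2, errCoef, smul_eq_mul]
  push_cast
  field_simp
  ring

end Exceptional

/-! ### Polynomial inequalities by Bernstein expansion -/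

/-- Products of Bernstein type are positive. -/
lemma bernstein_pos {a b c d x y : ℝ} (h₁ : a < x) (h₂ : x < b) (h₃ : c < y) (h₄ : y < d)
    (i j k l : ℕ) : 0 < (x - a) ^ i * (b - x) ^ j * (y - c) ^ k * (d - y) ^ l := by
  have := sub_pos.2 h₁
  have := sub_pos.2 h₂
  have := sub_pos.2 h₃
  have := sub_pos.2 h₄
  positivity

lemma bernstein_nonneg {a b c d x y : ℝ} (h₁ : a ≤ x) (h₂ : x ≤ b) (h₃ : c ≤ y) (h₄ : y ≤ d)
    (i j k l : ℕ) : 0 ≤ (x - a) ^ i * (b - x) ^ j * (y - c) ^ k * (d - y) ^ l := by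
  have := sub_nonneg.2 h₁
  have := sub_nonneg.2 h₂
  have := sub_nonneg.2 h₃
  have := sub_nonneg.2 h₄
  positivity

/-- Up to positive factors, the `lubich` polynomials are minus the `V` part of a five-shift stencil
divided by `σ ^ 2`, and the `lubich_sq` polynomials minus its `V ^ 2` part divided by `σ`. Each
inequality is a nonnegative combination of Bernstein products on the rectangle in question. -/
lemma poly_zero_neg_one_lubich_pos {α σ : ℝ} (h₁ : 1 < α) (h₂ : α < 2) (h₃ : 0 < σ)
    (h₄ : σ < 1) :
    0 < -16 + 56 / 3 * α - 8 / 3 * α ^ 2 + (112 / 3 * α - 56 / 9 * α ^ 2) * σ -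
      (16 * α + 16 / 3 * α ^ 2) * σ ^ 2 := by
  have B := bernstein_pos h₁ h₂ h₃ h₄
  linarith [
    B 0 2 0 2, B 1 1 0 2, B 2 0 0 2, B 0 2 1 1, B 1 1 1 1, B 2 0 1 1, B 0 2 2 0, B 1 1 2 0,
    B 2 0 2 0]

lemma poly_zero_neg_one_lubich_sq_nonneg {α σ : ℝ} (h₁ : 1 ≤ α) (h₂ : α ≤ 2) (h₃ : 0 ≤ σ)
    (h₄ : σ ≤ 1) :
    0 ≤ 16 - 8 / 3 * α + (48 - 88 / 3 * α + 32 / 9 * α ^ 2) * σ -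
      (80 * α - 64 / 3 * α ^ 2) * σ ^ 2 + (-128 + 304 / 3 * α + 32 / 3 * α ^ 2) * σ ^ 3 +
      (896 / 3 * α - 448 / 9 * α ^ 2) * σ ^ 4 - (128 * α + 128 / 3 * α ^ 2) * σ ^ 5 := by
  have B := bernstein_nonneg h₁ h₂ h₃ h₄
  linarith [
    B 0 2 0 5, B 1 1 0 5, B 2 0 0 5, B 0 2 1 4, B 1 1 1 4, B 2 0 1 4, B 0 2 2 3, B 1 1 2 3,
    B 2 0 2 3, B 0 2 3 2, B 1 1 3 2, B 2 0 3 2, B 0 2 4 1, B 1 1 4 1, B 2 0 4 1, B 0 2 5 0,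
    B 1 1 5 0, B 2 0 5 0]

lemma poly_neg_one_neg_two_lubich_pos {α σ : ℝ} (h₁ : 1 < α) (h₂ : α < 2) (h₃ : 0 < σ)
    (h₄ : σ < 1) :
    0 < 8 - 64 / 3 * α + 40 / 3 * α ^ 2 + (-56 / 3 * α + 280 / 9 * α ^ 2) * σ +
      (224 / 3 * α - 448 / 9 * α ^ 2) * σ ^ 2 := by
  have B := bernstein_pos h₁ h₂ h₃ h₄
  linarith [
    B 0 2 0 2, B 1 1 0 2, B 2 0 0 2, B 0 2 1 1, B 1 1 1 1, B 2 0 1 1, B 0 2 2 0, B 1 1 2 0,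
    B 2 0 2 0]

lemma poly_neg_one_neg_two_lubich_sq_nonneg_of_le_half {α σ : ℝ} (h₁ : 3 / 2 ≤ α) (h₂ : α ≤ 2) (h₃ : 0 ≤ σ)
    (h₄ : σ ≤ 1 / 2) :
    0 ≤ -8 + 40 / 3 * α + (-24 + 152 / 3 * α - 160 / 9 * α ^ 2) * σ -
      (80 / 3 * α + 272 / 9 * α ^ 2) * σ ^ 2 + (64 - 1040 / 3 * α + 176 * α ^ 2) * σ ^ 3 +
      (-448 / 3 * α + 2240 / 9 * α ^ 2) * σ ^ 4 +
      (1792 / 3 * α - 3584 / 9 * α ^ 2) * σ ^ 5 := by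
  have B := bernstein_nonneg h₁ h₂ h₃ h₄
  linarith [
    B 0 2 0 5, B 1 1 0 5, B 2 0 0 5, B 0 2 1 4, B 1 1 1 4, B 2 0 1 4, B 0 2 2 3, B 1 1 2 3,
    B 2 0 2 3, B 0 2 3 2, B 1 1 3 2, B 2 0 3 2, B 0 2 4 1, B 1 1 4 1, B 2 0 4 1, B 0 2 5 0,
    B 1 1 5 0, B 2 0 5 0]

lemma poly_neg_one_neg_two_lubich_sq_nonneg_of_half_le {α σ : ℝ} (h₁ : 3 / 2 ≤ α) (h₂ : α ≤ 2) (h₃ : 1 / 2 ≤ σ)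
    (h₄ : σ ≤ 1) :
    0 ≤ -8 + 40 / 3 * α + (-24 + 152 / 3 * α - 160 / 9 * α ^ 2) * σ -
      (80 / 3 * α + 272 / 9 * α ^ 2) * σ ^ 2 + (64 - 1040 / 3 * α + 176 * α ^ 2) * σ ^ 3 +
      (-448 / 3 * α + 2240 / 9 * α ^ 2) * σ ^ 4 +
      (1792 / 3 * α - 3584 / 9 * α ^ 2) * σ ^ 5 := by
  have B := bernstein_nonneg h₁ h₂ h₃ h₄
  linarith [
    B 0 2 0 5, B 1 1 0 5, B 2 0 0 5, B 0 2 1 4, B 1 1 1 4, B 2 0 1 4, B 0 2 2 3, B 1 1 2 3,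
    B 2 0 2 3, B 0 2 3 2, B 1 1 3 2, B 2 0 3 2, B 0 2 4 1, B 1 1 4 1, B 2 0 4 1, B 0 2 5 0,
    B 1 1 5 0, B 2 0 5 0]

/-- The `V ^ 2` polynomial alone is negative for `α` near `1` and `σ` near `1 / 2`; the `V`
polynomial, with the weight `4 σ ^ 2`, compensates for it. -/
lemma poly_neg_one_neg_two_mixed_nonneg_of_le_half {α σ : ℝ} (h₁ : 1 ≤ α) (h₂ : α ≤ 3 / 2) (h₃ : 0 ≤ σ)
    (h₄ : σ ≤ 1 / 2) :
    0 ≤ 4 * σ ^ 2 * (8 - 64 / 3 * α + 40 / 3 * α ^ 2 + (-56 / 3 * α + 280 / 9 * α ^ 2) * σ +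
      (224 / 3 * α - 448 / 9 * α ^ 2) * σ ^ 2) +
      (-8 + 40 / 3 * α + (-24 + 152 / 3 * α - 160 / 9 * α ^ 2) * σ -
      (80 / 3 * α + 272 / 9 * α ^ 2) * σ ^ 2 + (64 - 1040 / 3 * α + 176 * α ^ 2) * σ ^ 3 +
      (-448 / 3 * α + 2240 / 9 * α ^ 2) * σ ^ 4 +
      (1792 / 3 * α - 3584 / 9 * α ^ 2) * σ ^ 5) := by
  have B := bernstein_nonneg h₁ h₂ h₃ h₄
  linarith [
    B 0 2 0 5, B 1 1 0 5, B 2 0 0 5, B 0 2 1 4, B 1 1 1 4, B 2 0 1 4, B 0 2 2 3, B 1 1 2 3,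
    B 2 0 2 3, B 0 2 3 2, B 1 1 3 2, B 2 0 3 2, B 0 2 4 1, B 1 1 4 1, B 2 0 4 1, B 0 2 5 0,
    B 1 1 5 0, B 2 0 5 0]

lemma poly_neg_one_neg_two_mixed_nonneg_of_half_le {α σ : ℝ} (h₁ : 1 ≤ α) (h₂ : α ≤ 3 / 2) (h₃ : 1 / 2 ≤ σ)
    (h₄ : σ ≤ 1) :
    0 ≤ 4 * σ ^ 2 * (8 - 64 / 3 * α + 40 / 3 * α ^ 2 + (-56 / 3 * α + 280 / 9 * α ^ 2) * σ +
      (224 / 3 * α - 448 / 9 * α ^ 2) * σ ^ 2) +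
      (-8 + 40 / 3 * α + (-24 + 152 / 3 * α - 160 / 9 * α ^ 2) * σ -
      (80 / 3 * α + 272 / 9 * α ^ 2) * σ ^ 2 + (64 - 1040 / 3 * α + 176 * α ^ 2) * σ ^ 3 +
      (-448 / 3 * α + 2240 / 9 * α ^ 2) * σ ^ 4 +
      (1792 / 3 * α - 3584 / 9 * α ^ 2) * σ ^ 5) := by
  have B := bernstein_nonneg h₁ h₂ h₃ h₄
  linarith [
    B 0 2 0 5, B 1 1 0 5, B 2 0 0 5, B 0 2 1 4, B 1 1 1 4, B 2 0 1 4, B 0 2 2 3, B 1 1 2 3,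
    B 2 0 2 3, B 0 2 3 2, B 1 1 3 2, B 2 0 3 2, B 0 2 4 1, B 1 1 4 1, B 2 0 4 1, B 0 2 5 0,
    B 1 1 5 0, B 2 0 5 0]

/-! ### Negativity of the symbol for every effective choice of shifts -/

section Symbol

variable {α ρ₁ ρ₂ : ℝ} {z : ℂ}

lemma stencil4_neg_zero_neg_one (hα : 1 < α) (hα' : α < 2) (hz : ‖z‖ = 1) (him : z.im ≠ 0)
    (h₁ : 0 < ρ₁) (h₂ : 0 < ρ₂) :
    stencil4 α ⟨1, 0, 1, -1, 1, 2, 1, -2⟩ (realSymbol ρ₁ ρ₂ z) < 0 := by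
  obtain ⟨σ, hσ, hσ0, hσ1⟩ := exists_re_eq hz him
  refine neg_of_mul_neg_right (a := 2 * (6 - α)) ?_ (by linarith)
  rw [stencil4_zero_neg_one_two_neg_two _ hα']
  obtain ⟨p1, p2, p3, p4, p5⟩ := re_lubich_mul_table hz hσ
  obtain ⟨q1, q2, q3, q4, q5⟩ := re_lubich_sq_mul_table hz hσ
  simp only [realSymbol, p1, p2, p3, p4, p5, q1, q2, q3, q4, q5]
  have m1 : 0 < -16 + 56 / 3 * α - 8 / 3 * α ^ 2 + (112 / 3 * α - 56 / 9 * α ^ 2) * σ -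
      (16 * α + 16 / 3 * α ^ 2) * σ ^ 2 :=
    poly_zero_neg_one_lubich_pos hα hα' hσ0 hσ1
  have m2 : 0 ≤ 16 - 8 / 3 * α + (48 - 88 / 3 * α + 32 / 9 * α ^ 2) * σ -
      (80 * α - 64 / 3 * α ^ 2) * σ ^ 2 + (-128 + 304 / 3 * α + 32 / 3 * α ^ 2) * σ ^ 3 +
      (896 / 3 * α - 448 / 9 * α ^ 2) * σ ^ 4 - (128 * α + 128 / 3 * α ^ 2) * σ ^ 5 :=
    poly_zero_neg_one_lubich_sq_nonneg hα.le hα'.le hσ0.le hσ1.le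
  have e1 := mul_pos h₁ (mul_pos (mul_pos hσ0 hσ0) m1)
  have e2 := mul_nonneg h₂.le (mul_nonneg hσ0.le m2)
  linarith

/-- For `α ≤ 3 / 2` the `V ^ 2` part may have the wrong sign. The relation `ρ₂ ‖V‖ ≤ ρ₁` then makes
the `V` part heavy enough to absorb it. -/
lemma stencil4_neg_neg_one_neg_two (hα : 1 < α) (hα' : α < 2) (hz : ‖z‖ = 1) (him : z.im ≠ 0)
    (h₁ : 0 < ρ₁) (h₂ : 0 < ρ₂) (h₃ : α ≤ 3 / 2 → ρ₂ * ‖lubich z‖ ≤ ρ₁) :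
    stencil4 α ⟨1, 2, 1, 0, 1, -1, 1, -2⟩ (realSymbol ρ₁ ρ₂ z) < 0 := by
  obtain ⟨σ, hσ, hσ0, hσ1⟩ := exists_re_eq hz him
  refine neg_of_mul_neg_right (a := 2 * (5 * α - 3)) ?_ (by linarith)
  rw [stencil4_two_zero_neg_one_neg_two _ hα]
  obtain ⟨p1, p2, p3, p4, p5⟩ := re_lubich_mul_table hz hσ
  obtain ⟨q1, q2, q3, q4, q5⟩ := re_lubich_sq_mul_table hz hσ
  simp only [realSymbol, p1, p2, p3, p4, p5, q1, q2, q3, q4, q5]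
  have m1 : 0 < 8 - 64 / 3 * α + 40 / 3 * α ^ 2 + (-56 / 3 * α + 280 / 9 * α ^ 2) * σ +
      (224 / 3 * α - 448 / 9 * α ^ 2) * σ ^ 2 :=
    poly_neg_one_neg_two_lubich_pos hα hα' hσ0 hσ1
  have e1 := mul_pos (mul_pos hσ0 hσ0) m1
  rcases le_or_gt α (3 / 2) with h | h
  -- `‖V‖ ^ 2 = 4 σ (1 + 3 σ)` exceeds `16 σ ^ 2` because `σ < 1`.
  · have hV : 4 * σ < ‖lubich z‖ := by
      refine (abs_lt_of_sq_lt_sq' ?_ (norm_nonneg _)).2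
      rw [norm_lubich_sq hz hσ]
      nlinarith
    have hρ : 4 * σ * ρ₂ < ρ₁ := by nlinarith [h₃ h]
    have m2 : 0 ≤ 4 * σ ^ 2 * (8 - 64 / 3 * α + 40 / 3 * α ^ 2 +
        (-56 / 3 * α + 280 / 9 * α ^ 2) * σ + (224 / 3 * α - 448 / 9 * α ^ 2) * σ ^ 2) +
      (-8 + 40 / 3 * α + (-24 + 152 / 3 * α - 160 / 9 * α ^ 2) * σ -
        (80 / 3 * α + 272 / 9 * α ^ 2) * σ ^ 2 + (64 - 1040 / 3 * α + 176 * α ^ 2) * σ ^ 3 +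
        (-448 / 3 * α + 2240 / 9 * α ^ 2) * σ ^ 4 +
        (1792 / 3 * α - 3584 / 9 * α ^ 2) * σ ^ 5) := by
      rcases le_total σ (1 / 2) with h' | h'
      · exact poly_neg_one_neg_two_mixed_nonneg_of_le_half hα.le h hσ0.le h'
      · exact poly_neg_one_neg_two_mixed_nonneg_of_half_le hα.le h h' hσ1.le
    have e2 := mul_nonneg h₂.le (mul_nonneg hσ0.le m2)
    have e3 := mul_pos (sub_pos.2 hρ) e1
    linarith
  · have m2 : 0 ≤ -8 + 40 / 3 * α + (-24 + 152 / 3 * α - 160 / 9 * α ^ 2) * σ -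
        (80 / 3 * α + 272 / 9 * α ^ 2) * σ ^ 2 + (64 - 1040 / 3 * α + 176 * α ^ 2) * σ ^ 3 +
        (-448 / 3 * α + 2240 / 9 * α ^ 2) * σ ^ 4 +
        (1792 / 3 * α - 3584 / 9 * α ^ 2) * σ ^ 5 := by
      rcases le_total σ (1 / 2) with h' | h'
      · exact poly_neg_one_neg_two_lubich_sq_nonneg_of_le_half h.le hα'.le hσ0.le h'
      · exact poly_neg_one_neg_two_lubich_sq_nonneg_of_half_le h.le hα'.le h' hσ1.le
    have e2 := mul_nonneg h₂.le (mul_nonneg hσ0.le m2)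
    have e3 := mul_pos h₁ e1
    linarith

lemma errCoef_sub_pos (hα : 1 < α) (hα' : α < 2) {k s : ℤ} (hk : 2 ≤ k) (hs : s ≤ -2)
    (hks : 3 ≤ k ∨ s ≤ -3) : 0 < errCoef α 2 (-2) - errCoef α k s := by
  simp only [errCoef]
  have hk' : (2 : ℝ) ≤ k := by exact_mod_cast hk
  have hs' : (s : ℝ) ≤ -2 := by exact_mod_cast hs
  rcases hks with h | h
  · have h' : (3 : ℝ) ≤ k := by exact_mod_cast h
    nlinarith
  · have h' : (s : ℝ) ≤ -3 := by exact_mod_cast h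
    nlinarith

lemma stencil4_neg_family (hα : 1 < α) (hα' : α < 2) (hz : ‖z‖ = 1) (him : z.im ≠ 0)
    (h₁ : 0 < ρ₁) (h₂ : 0 < ρ₂) {k s : ℤ} (hk : 2 ≤ k) (hs : s ≤ -2)
    (hks : (k, s) ≠ (2, -2)) :
    stencil4 α ⟨1, 2, 1, -2, 1, k, 1, s⟩ (realSymbol ρ₁ ρ₂ z) < 0 := by
  rcases hk.eq_or_lt with rfl | hk3
  · have hs3 : s ≤ -3 := by
      rcases hs.eq_or_lt with rfl | h
      · exact absurd rfl hks
      · omega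
    rw [stencil4_family_two (by linarith) hs3]
    exact fourthOrder_realSymbol_neg hz him hα hα' h₁ h₂ (Or.inl (by rw [abs_of_neg] <;> omega))
  · have hk3 : 3 ≤ k := by omega
    rcases hs.eq_or_lt with rfl | hs3
    · rw [stencil4_family_neg_two (by linarith) hk3]
      exact fourthOrder_realSymbol_neg hz him hα hα' h₁ h₂
        (Or.inl (by rw [abs_of_pos] <;> omega))
    · have hs3 : s ≤ -3 := by omega
      have hΔ := errCoef_sub_pos hα hα' hk hs (Or.inl hk3)
      have hk' : (3 : ℝ) ≤ k := by exact_mod_cast hk3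
      have hs' : (s : ℝ) ≤ -3 := by exact_mod_cast hs3
      refine neg_of_mul_neg_right (a := (k - s) * (errCoef α 2 (-2) - errCoef α k s)) ?_
        (mul_nonneg (by linarith) hΔ.le)
      rw [stencil4_family hk3 hs3 (by intro h; linarith)]
      have f1 := fourthOrder_realSymbol_neg hz him hα hα' h₁ h₂ (n := k)
        (Or.inl (by rw [abs_of_pos] <;> omega))
      have f2 := fourthOrder_realSymbol_neg hz him hα hα' h₁ h₂ (n := s)
        (Or.inl (by rw [abs_of_neg] <;> omega))
      exact add_neg
        (mul_neg_of_pos_of_neg (mul_pos (by linarith) (by nlinarith)) f1)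
        (mul_neg_of_pos_of_neg (mul_pos (by linarith) (by nlinarith)) f2)

/-- The symbol of an effective fourth order discretization has negative real part. -/
theorem stencil4_realSymbol_neg {S : Shifts} (hS : S.Effective) (hα : 1 < α) (hα' : α < 2)
    (hN : S.Nondegenerate α) (hz : ‖z‖ = 1) (him : z.im ≠ 0) (h₁ : 0 < ρ₁) (h₂ : 0 < ρ₂)
    (h₃ : α ≤ 3 / 2 → ρ₂ * ‖lubich z‖ ≤ ρ₁) :
    stencil4 α S (realSymbol ρ₁ ρ₂ z) < 0 := by
  have hα0 : 0 < α := by linarith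
  have hα3 : α < 3 := by linarith
  have H0 := fourthOrder_realSymbol_neg hz him hα hα' h₁ h₂ (n := 0) (by simp)
  have H1 := fourthOrder_realSymbol_neg hz him hα hα' h₁ h₂ (n := -1) (by simp)
  rcases hS with ⟨q', s', rfl, hq, hs, hqs, hlt⟩ | rfl | rfl | rfl | rfl | rfl | rfl | rfl
  · rcases mul_neg_iff.mp hlt with ⟨h, h'⟩ | ⟨h, h'⟩
    · rw [abs_of_pos h] at hq
      rw [abs_of_neg h'] at hs
      exact stencil4_neg_family hα hα' hz him h₁ h₂ hq (by omega) hqs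
    · rw [abs_of_neg h] at hq
      rw [abs_of_pos h'] at hs
      have h'r : (0 : ℝ) < s' := by exact_mod_cast h'
      have hr : (q' : ℝ) < 0 := by exact_mod_cast h
      rw [stencil4_swap α (by norm_num) (by intro h0; linarith)]
      -- The pair `(q̄, s̄) = (-2, 2)` is not excluded by the list; it repeats the first third order
      -- combination and is excluded by nondegeneracy.
      refine stencil4_neg_family hα hα' hz him h₁ h₂ hs (by omega) fun h2 => ?_
      obtain ⟨rfl, rfl⟩ := Prod.mk.inj h2
      apply nondegenerate_one hN
      simp only [errCoef]
      push_cast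
      ring
  · rwa [stencil4_two_zero_two_neg_two _ hα0]
  · exact stencil4_neg_neg_one_neg_two hα hα' hz him h₁ h₂ h₃
  · rwa [stencil4_two_neg_one_two_neg_two _ hα0]
  · rw [stencil4_two_neg_one_neg_one_neg_two]
    · exact H1
    -- For these shifts nondegeneracy amounts to `α ≠ 3 / 2`.
    · have := nondegenerate_one hN
      intro h
      apply this
      simp only [errCoef]
      push_cast
      linear_combination (4 / 3) * h
  · exact stencil4_neg_zero_neg_one hα hα' hz him h₁ h₂
  · rwa [stencil4_zero_neg_two_two_neg_two _ hα3]
  · rwa [stencil4_neg_one_neg_two_two_neg_two _ hα3]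

end Symbol

/-! ### Boundary values of the generating functions -/

section BoundaryValues

open Filter Topology

variable {α : ℝ}

lemma g_eq_choose (α : ℝ) (k : ℕ) : g α k = (-1) ^ k * Ring.choose α k := by
  induction k with
  | zero => simp [g]
  | succ k ih =>
    have h : Ring.choose α (k + 1) * (k + 1) = Ring.choose α k * (α - k) := by
      rw [Ring.choose_eq_smul, Ring.choose_eq_smul, descPochhammer_succ_right,
        Polynomial.smeval_mul, Nat.factorial_succ]
      simp only [Polynomial.smeval_sub, Polynomial.smeval_X, Polynomial.smeval_natCast, pow_one,
        pow_zero, nsmul_eq_mul, mul_one, smul_eq_mul]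
      have : (k.factorial : ℝ) ≠ 0 := by positivity
      have : (k : ℝ) + 1 ≠ 0 := by positivity
      push_cast
      field_simp
    have h1 : (k : ℝ) + 1 ≠ 0 := by positivity
    have h2 : Ring.choose α (k + 1) = Ring.choose α k * (α - k) / (k + 1) := by
      rw [eq_div_iff h1, h]
    rw [g, ih, h2]
    field_simp
    ring

lemma hasSum_g_of_norm_lt_one (α : ℝ) {ζ : ℂ} (hζ : ‖ζ‖ < 1) :
    HasSum (fun k => (g α k : ℂ) * ζ ^ k) ((1 - ζ) ^ (α : ℂ)) := by
  have h := (Complex.one_add_cpow_hasFPowerSeriesOnBall_zero (a := (α : ℂ))).hasSum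
    (y := -ζ) (by
      rw [← ENNReal.ofReal_one, Metric.eball_ofReal]
      simpa using hζ)
  simp only [zero_add, binomialSeries_apply, List.ofFn_const, List.prod_replicate] at h
  rw [← sub_eq_add_neg] at h
  convert! h using 2 with k
  rw [g_eq_choose, neg_pow ζ, smul_eq_mul]
  push_cast
  ring

lemma g_pos (hα : 1 < α) (hα' : α < 2) (k : ℕ) : 0 < g α (k + 2) := by
  induction k with
  | zero => norm_num [g]; nlinarith
  | succ k ih =>
    rw [show k + 1 + 2 = (k + 2) + 1 by ring, g]
    refine mul_pos ?_ ih
    have : (0 : ℝ) < ((k + 2 : ℕ) : ℝ) + 1 := by positivity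
    rw [sub_pos, div_lt_one this]
    push_cast
    have : (0 : ℝ) ≤ k := by positivity
    linarith

/-- The partial sums are the coefficients of `(1 - ζ) ^ (α - 1)`. The closed form shows their sign,
which yields summability. -/
lemma sum_range_g (α : ℝ) (n : ℕ) :
    α * ∑ k ∈ Finset.range (n + 1), g α k = -(n + 1) * g α (n + 1) := by
  induction n with
  | zero => simp [g]
  | succ n ih =>
    rw [Finset.sum_range_succ, mul_add, ih, g.eq_2 α (n + 1)]
    have : (n : ℝ) + 1 + 1 ≠ 0 := by positivity
    push_cast
    field_simp
    ring

/-- From index two on the terms are positive, and nonpositive partial sums bound their total by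
`-(g_0 + g_1) = α - 1`. -/
lemma summable_g (hα : 1 < α) (hα' : α < 2) : Summable (g α) := by
  rw [← summable_nat_add_iff 2]
  refine summable_of_sum_range_le (c := α - 1) (fun k => (g_pos hα hα' k).le) fun n => ?_
  rcases n with _ | n
  · simp; linarith
  have h := sum_range_g α (n + 2)
  have h2 := g_pos hα hα' (n + 1)
  rw [Finset.sum_range_succ', Finset.sum_range_succ'] at h
  have h0 : g α 0 = 1 := rfl
  have h1 : g α (0 + 1) = -α := by simp [g]
  rw [h0, h1] at h
  have h3 : α * (∑ k ∈ Finset.range (n + 1), g α (k + 1 + 1) + -α + 1) ≤ 0 := by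
    rw [h]
    have : (0 : ℝ) ≤ ((n + 2 : ℕ) : ℝ) + 1 := by positivity
    nlinarith [mul_nonneg this h2.le]
  have h4 := nonpos_of_mul_nonpos_right h3 (by linarith)
  linarith

/-- Abel's limit theorem along the radius; `Re ζ < 1` keeps `1 - ζ` off the branch cut. -/
lemma hasSum_g (hα : 1 < α) (hα' : α < 2) {ζ : ℂ} (hζ : ‖ζ‖ = 1) (hre : ζ.re < 1) :
    HasSum (fun k => (g α k : ℂ) * ζ ^ k) ((1 - ζ) ^ (α : ℂ)) := by
  have hs : Summable (fun k => (g α k : ℂ) * ζ ^ k) := by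
    refine Summable.of_norm ?_
    simpa [norm_mul, norm_pow, hζ] using (summable_g hα hα').abs
  have h1 := Complex.tendsto_tsum_powerSeries_nhdsWithin_lt hs.hasSum.tendsto_sum_nat
  rw [tendsto_map'_iff] at h1
  have h2 : Tendsto (fun x : ℝ => (1 - (x : ℂ) * ζ) ^ (α : ℂ)) (𝓝[<] 1)
      (𝓝 ((1 - ζ) ^ (α : ℂ))) := by
    have : ContinuousAt (fun x : ℝ => (1 - (x : ℂ) * ζ) ^ (α : ℂ)) 1 := by
      apply ContinuousAt.cpow
      · fun_prop
      · fun_prop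
      · left; simpa using hre
    have h := this.tendsto
    simp only [Complex.ofReal_one, one_mul] at h
    exact h.mono_left nhdsWithin_le_nhds
  have h3 : (fun x : ℝ => (1 - (x : ℂ) * ζ) ^ (α : ℂ)) =ᶠ[𝓝[<] 1]
      ((fun z : ℂ => ∑' n, (g α n : ℂ) * ζ ^ n * z ^ n) ∘ Complex.ofReal) := by
    filter_upwards [Ioo_mem_nhdsLT (show (0 : ℝ) < 1 by norm_num)] with x hx
    rw [← (hasSum_g_of_norm_lt_one α (ζ := (x : ℂ) * ζ) (by
      rw [norm_mul, hζ, Complex.norm_real, Real.norm_of_nonneg hx.1.le]; linarith [hx.2])).tsum_eq]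
    refine tsum_congr fun k => ?_
    rw [mul_pow]; ring
  rw [tendsto_nhds_unique h2 (h1.congr' h3.symm)]
  exact hs.hasSum

lemma cpow_mul_of_arg {x y : ℂ} (hx : x ≠ 0) (hy : y ≠ 0)
    (h : x.arg + y.arg ∈ Set.Ioc (-Real.pi) Real.pi) (a : ℂ) :
    (x * y) ^ a = x ^ a * y ^ a := by
  rw [Complex.cpow_def_of_ne_zero (mul_ne_zero hx hy), Complex.cpow_def_of_ne_zero hx,
    Complex.cpow_def_of_ne_zero hy, Complex.log_mul hx hy h, add_mul, Complex.exp_add]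

lemma summable_norm_g_pow (hα : 1 < α) (hα' : α < 2) {ζ : ℂ} (hζ : ‖ζ‖ ≤ 1) :
    Summable fun k => ‖(g α k : ℂ) * ζ ^ k‖ := by
  refine Summable.of_nonneg_of_le (fun _ => norm_nonneg _) (fun k => ?_) (summable_g hα hα').abs
  rw [norm_mul, norm_pow, Complex.norm_real, Real.norm_eq_abs]
  exact mul_le_of_le_one_right (abs_nonneg _) (pow_le_one₀ (norm_nonneg _) hζ)

lemma q_natCast_mul_pow (α : ℝ) (ζ : ℂ) (k : ℕ) :
    (q α k : ℂ) * ζ ^ k = ((3 / 2 : ℝ) ^ α : ℝ) * ∑ m ∈ Finset.range (k + 1),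
      ((g α m : ℂ) * (ζ / 3) ^ m) * ((g α (k - m) : ℂ) * ζ ^ (k - m)) := by
  simp only [q, Int.toNat_natCast, Int.not_ofNat_neg, if_false]
  push_cast
  rw [mul_assoc, Finset.sum_mul]
  congr 1
  refine Finset.sum_congr rfl fun m hm => ?_
  have hm : m ≤ k := by simpa [Nat.lt_succ_iff] using hm
  obtain ⟨j, rfl⟩ := Nat.exists_eq_add_of_le hm
  rw [Nat.add_sub_cancel_left, pow_add, div_pow]
  ring

lemma summable_norm_q_pow (hα : 1 < α) (hα' : α < 2) {ζ : ℂ} (hζ : ‖ζ‖ ≤ 1) :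
    Summable fun k : ℕ => ‖(q α k : ℂ) * ζ ^ k‖ := by
  simp only [q_natCast_mul_pow, norm_mul]
  refine Summable.mul_left _ ?_
  have h3 : ‖ζ / 3‖ ≤ 1 := by rw [norm_div, Complex.norm_ofNat]; linarith
  simpa only [norm_mul] using summable_norm_sum_mul_range_of_summable_norm
    (summable_norm_g_pow hα hα' h3) (summable_norm_g_pow hα hα' hζ)

/-- The power series with coefficients `q α k` has boundary values `(3/2 - 2ζ + ζ²/2) ^ α`. -/
lemma hasSum_q (hα : 1 < α) (hα' : α < 2) {ζ : ℂ} (hζ : ‖ζ‖ = 1) (him : ζ.im ≠ 0) :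
    HasSum (fun k : ℕ => (q α k : ℂ) * ζ ^ k) (lubich ζ⁻¹ ^ (α : ℂ)) := by
  have hn := normSq_eq_one hζ
  have him2 : 0 < ζ.im * ζ.im := mul_self_pos.2 him
  have hre : ζ.re < 1 := by nlinarith
  have hre' : ζ.re / 3 < 1 := by linarith
  have h3 : ‖ζ / 3‖ < 1 := by rw [norm_div, Complex.norm_ofNat]; linarith
  have hs := hasSum_sum_range_mul_of_summable_norm (summable_norm_g_pow hα hα' h3.le)
    (summable_norm_g_pow hα hα' hζ.le)
  rw [(hasSum_g_of_norm_lt_one α h3).tsum_eq, (hasSum_g hα hα' hζ hre).tsum_eq] at hs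
  have hs := hs.mul_left (((3 / 2 : ℝ) ^ α : ℝ) : ℂ)
  simp only [← q_natCast_mul_pow] at hs
  have r1 : 0 < (1 - ζ).re := by simpa using hre
  have r2 : 0 < (1 - ζ / 3).re := by simpa [Complex.div_ofNat_re] using hre'
  have n1 : 1 - ζ ≠ 0 := by intro h; rw [h] at r1; simp at r1
  have n2 : 1 - ζ / 3 ≠ 0 := by intro h; rw [h] at r2; simp at r2
  have a1 := abs_lt.mp (Complex.abs_arg_lt_pi_div_two_iff.mpr (Or.inl r1))
  have a2 := abs_lt.mp (Complex.abs_arg_lt_pi_div_two_iff.mpr (Or.inl r2))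
  -- Both nonconstant factors have positive real part, so their arguments add without leaving `(-π,
  -- π)` and the power is multiplicative.
  have e : lubich ζ⁻¹ = ((3 / 2 : ℝ) : ℂ) * ((1 - ζ / 3) * (1 - ζ)) := by
    simp only [lubich, inv_inv]; push_cast; ring
  rw [e, cpow_mul_of_arg (by norm_num) (mul_ne_zero n2 n1),
    cpow_mul_of_arg n2 n1, ← Complex.ofReal_cpow (by norm_num)]
  · exact hs
  · constructor <;> linarith [a1.1, a1.2, a2.1, a2.2]
  · rw [Complex.arg_ofReal_of_nonneg (by norm_num), zero_add]
    exact Complex.arg_mem_Ioc _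

lemma lubich_im_ne_zero {z : ℂ} (hz : ‖z‖ = 1) (him : z.im ≠ 0) : (lubich z).im ≠ 0 := by
  have hn := normSq_eq_one hz
  have e : (lubich z).im = z.im * (2 - z.re) := by
    rw [lubich, inv_eq_conj_of_norm_eq_one hz]
    simp [pow_two, Complex.div_ofNat_im]
    ring
  rw [e]
  refine mul_ne_zero him ?_
  nlinarith [mul_self_nonneg z.im]

/-- For `1 < α < 2`, the power `w ^ α` is a positive combination of `w` and `w ^ 2`. -/
lemma cpow_eq_combination (hα : 1 < α) (hα' : α < 2) {w : ℂ} (hw : w.im ≠ 0) :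
    ∃ ρ₁ ρ₂ : ℝ, 0 < ρ₁ ∧ 0 < ρ₂ ∧ w ^ (α : ℂ) = ρ₁ * w + ρ₂ * w ^ 2 ∧
      (α ≤ 3 / 2 → ρ₂ * ‖w‖ ≤ ρ₁) := by
  have hw0 : w ≠ 0 := by rintro rfl; simp at hw
  set r := ‖w‖ with hr
  have hr0 : 0 < r := norm_pos_iff.mpr hw0
  set θ := w.arg with hθ
  have hsin : Real.sin θ ≠ 0 := by
    rw [hθ, Complex.sin_arg]; exact div_ne_zero hw hr0.ne'
  have hθ0 : θ ≠ 0 := by intro h; rw [h] at hsin; simp at hsin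
  have hθpi : |θ| < Real.pi := by
    refine lt_of_le_of_ne (Complex.abs_arg_le_pi w) fun h => hsin ?_
    rcases abs_eq Real.pi_pos.le |>.mp h with h | h <;> rw [h] <;> simp
  have hθa : 0 < |θ| := abs_pos.mpr hθ0
  have hdiv : ∀ t : ℝ, Real.sin (t * θ) / Real.sin θ = Real.sin (t * |θ|) / Real.sin |θ| := by
    intro t
    rcases abs_choice θ with h | h <;> rw [h]
    rw [mul_neg, Real.sin_neg, Real.sin_neg, neg_div_neg_eq]
  have hs : 0 < Real.sin |θ| := Real.sin_pos_of_pos_of_lt_pi hθa hθpi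
  have hp : ∀ t : ℝ, 0 < t → t < 1 → 0 < Real.sin (t * |θ|) := fun t h0 h1 =>
    Real.sin_pos_of_pos_of_lt_pi (by positivity) (by nlinarith)
  -- Law of sines: `e^{iαθ}` is resolved along `e^{iθ}` and `e^{2iθ}`. The sine ratios depend only
  -- on `|θ|`, which lies in `(0, π)`.
  refine ⟨r ^ (α - 1) * (Real.sin ((2 - α) * θ) / Real.sin θ),
    r ^ (α - 2) * (Real.sin ((α - 1) * θ) / Real.sin θ), ?_, ?_, ?_, ?_⟩
  · rw [hdiv]
    exact mul_pos (Real.rpow_pos_of_pos hr0 _)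
      (div_pos (hp _ (by linarith) (by linarith)) hs)
  · rw [hdiv]
    exact mul_pos (Real.rpow_pos_of_pos hr0 _)
      (div_pos (hp _ (by linarith) (by linarith)) hs)
  · have hwe : w = r * Complex.exp (θ * Complex.I) := (Complex.norm_mul_exp_arg_mul_I w).symm
    have e1 : w ^ (α : ℂ) = (r ^ α : ℝ) * Complex.exp ((α * θ : ℝ) * Complex.I) := by
      rw [Complex.cpow_def_of_ne_zero hw0, Complex.log, add_mul, Complex.exp_add, ← hr, ← hθ,
        Real.rpow_def_of_pos hr0]
      push_cast
      congr 2
      ring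
    have p1 : r ^ α = r ^ (α - 1) * r := by
      rw [← Real.rpow_add_one hr0.ne']; congr 1; ring
    have p2 : r ^ α = r ^ (α - 2) * r ^ 2 := by
      rw [← Real.rpow_natCast r 2, ← Real.rpow_add hr0]; congr 1; push_cast; ring
    have key : Complex.exp ((α * θ : ℝ) * Complex.I) =
        ((Real.sin ((2 - α) * θ) / Real.sin θ : ℝ) : ℂ) * Complex.exp (θ * Complex.I) +
          ((Real.sin ((α - 1) * θ) / Real.sin θ : ℝ) : ℂ) * Complex.exp (θ * Complex.I) ^ 2 := by
      have ea : α * θ = (α - 1) * θ + θ := by ring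
      have eb : (2 - α) * θ = θ - (α - 1) * θ := by ring
      have e2 : Complex.exp (θ * Complex.I) ^ 2 =
          Complex.exp (((θ + θ : ℝ) : ℂ) * Complex.I) := by
        rw [← Complex.exp_nat_mul]; congr 1; push_cast; ring
      rw [e2, ea, eb]
      apply Complex.ext
      · simp only [Complex.add_re, Complex.re_ofReal_mul, Complex.exp_ofReal_mul_I_re]
        rw [Real.cos_add, Real.cos_add, Real.sin_sub]
        field_simp
        ring
      · simp only [Complex.add_im, Complex.im_ofReal_mul, Complex.exp_ofReal_mul_I_im]
        rw [Real.sin_add, Real.sin_add, Real.sin_sub]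
        field_simp
        ring
    rw [e1, key, mul_add]
    have p1c : ((r ^ α : ℝ) : ℂ) = (r ^ (α - 1) : ℝ) * r := by rw [p1]; push_cast; rfl
    have p2c : ((r ^ α : ℝ) : ℂ) = (r ^ (α - 2) : ℝ) * r ^ 2 := by rw [p2]; push_cast; rfl
    rw [Complex.ofReal_mul, Complex.ofReal_mul]
    generalize ((Real.sin ((2 - α) * θ) / Real.sin θ : ℝ) : ℂ) = A at *
    generalize ((Real.sin ((α - 1) * θ) / Real.sin θ : ℝ) : ℂ) = B at *
    generalize Complex.exp (θ * Complex.I) = E at *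
    linear_combination (A * E) * p1c + (B * E ^ 2) * p2c - ((r ^ (α - 1) : ℝ) * A) * hwe -
      ((r ^ (α - 2) : ℝ) * B * (w + r * E)) * hwe
  · intro h
    rw [hdiv, hdiv]
    have p : r ^ (α - 1) = r ^ (α - 2) * r := by
      rw [← Real.rpow_add_one hr0.ne']; congr 1; ring
    rw [p]
    -- The difference is `2 sin ((3 - 2 α) |θ| / 2) cos (|θ| / 2)`.
    have hle : Real.sin ((α - 1) * |θ|) ≤ Real.sin ((2 - α) * |θ|) := by
      rw [← sub_nonneg, Real.sin_sub_sin]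
      refine mul_nonneg (mul_nonneg (by norm_num) ?_) ?_
      · exact Real.sin_nonneg_of_nonneg_of_le_pi (by nlinarith) (by nlinarith)
      · exact Real.cos_nonneg_of_neg_pi_div_two_le_of_le (by nlinarith) (by nlinarith)
    have := div_le_div_of_nonneg_right hle hs.le
    have hpos : 0 < r ^ (α - 2) * r := by positivity
    nlinarith [mul_le_mul_of_nonneg_left this hpos.le]

end BoundaryValues

/-! ### Negative definiteness of the fourth order Toeplitz matrices -/

section Fourier

open MeasureTheory

/-- The point `e ^ (i x)` of the unit circle. -/
def circ (x : ℝ) : ℂ := Complex.exp (x * Complex.I)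

@[fun_prop]
lemma continuous_circ : Continuous circ := by unfold circ; fun_prop

lemma norm_circ (x : ℝ) : ‖circ x‖ = 1 := Complex.norm_exp_ofReal_mul_I x

lemma circ_ne_zero (x : ℝ) : circ x ≠ 0 := Complex.exp_ne_zero _

lemma continuous_circ_zpow (m : ℤ) : Continuous fun x => circ x ^ m :=
  continuous_circ.zpow₀ m fun x => Or.inl (circ_ne_zero x)

lemma circ_im (x : ℝ) : (circ x).im = Real.sin x := Complex.exp_ofReal_mul_I_im x

lemma integral_circ_zpow (m : ℤ) :
    ∫ x in (0 : ℝ)..2 * Real.pi, circ x ^ m = if m = 0 then 2 * Real.pi else 0 := by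
  split_ifs with h
  · simp [h]
  · have hc : (m : ℂ) * Complex.I ≠ 0 :=
      mul_ne_zero (by exact_mod_cast h) Complex.I_ne_zero
    have e : ∀ x : ℝ, circ x ^ m = Complex.exp ((m * Complex.I) * x) := by
      intro x
      rw [circ, ← Complex.exp_int_mul]
      congr 1; ring
    simp only [e]
    rw [integral_exp_mul_complex hc]
    have : (m : ℂ) * Complex.I * ((2 * Real.pi : ℝ) : ℂ) = m * (2 * Real.pi * Complex.I) := by
      push_cast; ring
    rw [this, Complex.exp_int_mul_two_pi_mul_I]
    simp

variable {α : ℝ}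

/-- The generating function of the `q α k` on the unit circle. -/
def genFun (α : ℝ) (x : ℝ) : ℂ := ∑' k : ℕ, (q α k : ℂ) * circ x ^ k

lemma summable_norm_q (hα : 1 < α) (hα' : α < 2) : Summable fun k : ℕ => ‖(q α k : ℂ)‖ := by
  simpa using summable_norm_q_pow hα hα' (ζ := 1) (by simp)

lemma continuous_genFun (hα : 1 < α) (hα' : α < 2) : Continuous (genFun α) := by
  refine continuous_tsum (fun k => by fun_prop) (summable_norm_q hα hα') fun k x => ?_
  rw [norm_mul, norm_pow, norm_circ, one_pow, mul_one]

lemma hasSum_genFun (hα : 1 < α) (hα' : α < 2) (x : ℝ) :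
    HasSum (fun k : ℕ => (q α k : ℂ) * circ x ^ k) (genFun α x) :=
  (summable_norm_q_pow hα hα' (norm_circ x).le).of_norm.hasSum

lemma integral_genFun_mul (hα : 1 < α) (hα' : α < 2) (m : ℤ) :
    ∫ x in (0 : ℝ)..2 * Real.pi, genFun α x * circ x ^ (-m) = 2 * Real.pi * q α m := by
  have h := intervalIntegral.hasSum_integral_of_dominated_convergence (μ := volume)
    (a := 0) (b := 2 * Real.pi) (F := fun (k : ℕ) x => (q α k : ℂ) * circ x ^ k * circ x ^ (-m))
    (f := fun x => genFun α x * circ x ^ (-m)) (fun k _ => ‖(q α k : ℂ)‖)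
    (fun k => by
      have := continuous_circ_zpow (-m)
      exact Continuous.aestronglyMeasurable (by fun_prop))
    (fun k => Filter.Eventually.of_forall fun x _ => by
      rw [norm_mul, norm_mul, norm_pow, norm_zpow, norm_circ, one_pow, one_zpow, mul_one, mul_one])
    (Filter.Eventually.of_forall fun x _ => summable_norm_q hα hα')
    intervalIntegrable_const
    (Filter.Eventually.of_forall fun x _ => (hasSum_genFun hα hα' x).mul_right _)
  have e : ∀ k : ℕ, ∫ x in (0 : ℝ)..2 * Real.pi, (q α k : ℂ) * circ x ^ k * circ x ^ (-m) =
      q α k * if (k : ℤ) - m = 0 then 2 * Real.pi else 0 := by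
    intro k
    rw [← integral_circ_zpow, ← intervalIntegral.integral_const_mul]
    congr 1
    ext x
    rw [mul_assoc, ← zpow_natCast, ← zpow_add₀ (circ_ne_zero x), sub_eq_add_neg]
  simp only [e] at h
  refine h.unique ?_
  rcases lt_or_ge m 0 with hm | hm
  · have h0 : q α m = 0 := by simp [q, hm]
    rw [h0]
    convert! hasSum_zero using 1
    · ext k
      rw [if_neg (by omega), Complex.ofReal_zero, mul_zero]
    · simp
  · obtain ⟨n, rfl⟩ := Int.eq_ofNat_of_zero_le hm
    have hs := hasSum_single (f := fun k : ℕ => (q α k : ℂ) *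
      ((if (k : ℤ) - (n : ℤ) = 0 then 2 * Real.pi else 0 : ℝ) : ℂ)) n fun k hk => by
        rw [if_neg (by omega), Complex.ofReal_zero, mul_zero]
    convert! hs using 1
    simp
    ring

variable {n : ℕ}

/-- The trigonometric polynomial with coefficients `v`. -/
def trigPoly (v : Fin n → ℝ) (x : ℝ) : ℂ := ∑ j, (v j : ℂ) * circ x ^ (j : ℕ)

@[fun_prop]
lemma continuous_trigPoly (v : Fin n → ℝ) : Continuous (trigPoly v) := by
  unfold trigPoly; fun_prop

lemma normSq_trigPoly (v : Fin n → ℝ) (x : ℝ) :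
    (Complex.normSq (trigPoly v x) : ℂ) =
      ∑ i, ∑ j, (v i : ℂ) * v j * circ x ^ (-((i : ℤ) - (j : ℤ))) := by
  rw [Complex.normSq_eq_conj_mul_self, trigPoly, map_sum, Finset.sum_mul_sum]
  refine Finset.sum_congr rfl fun i _ => Finset.sum_congr rfl fun j _ => ?_
  rw [map_mul, map_pow, Complex.conj_ofReal, ← inv_eq_conj_of_norm_eq_one (norm_circ x),
    neg_sub, sub_eq_add_neg, zpow_add₀ (circ_ne_zero x), zpow_neg, zpow_natCast, zpow_natCast,
    inv_pow]
  ring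

/-- The integrand representing the quadratic form of the Toeplitz matrix with shift `p`. -/
def formIntegrand (α : ℝ) (v : Fin n → ℝ) (p : ℤ) (x : ℝ) : ℝ :=
  Complex.normSq (trigPoly v x) * (genFun α x * circ x ^ (-p)).re

lemma continuous_formIntegrand (hα : 1 < α) (hα' : α < 2) (v : Fin n → ℝ) (p : ℤ) :
    Continuous (formIntegrand α v p) := by
  have h1 := continuous_genFun hα hα'
  have h2 := continuous_circ_zpow (-p)
  have h3 : Continuous fun x => Complex.normSq (trigPoly v x) :=
    Complex.continuous_normSq.comp (continuous_trigPoly v)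
  unfold formIntegrand
  exact h3.mul (Complex.continuous_re.comp (h1.mul h2))

lemma integral_formIntegrand (hα : 1 < α) (hα' : α < 2) (v : Fin n → ℝ) (p : ℤ) :
    ∫ x in (0 : ℝ)..2 * Real.pi, formIntegrand α v p x =
      2 * Real.pi * (v ⬝ᵥ (A1 α n p *ᵥ v)) := by
  have hG := continuous_genFun hα hα'
  have e : ∀ x, formIntegrand α v p x =
      (∑ i, ∑ j, (v i : ℂ) * v j * (genFun α x * circ x ^ (-((i : ℤ) - (j : ℤ) + p)))).re := by
    intro x
    rw [formIntegrand, ← Complex.re_ofReal_mul, normSq_trigPoly, Finset.sum_mul]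
    congr 1
    refine Finset.sum_congr rfl fun i _ => ?_
    rw [Finset.sum_mul]
    refine Finset.sum_congr rfl fun j _ => ?_
    rw [neg_add, zpow_add₀ (circ_ne_zero x)]
    ring
  have hc : ∀ m : ℤ, Continuous fun x => genFun α x * circ x ^ (-m) := fun m =>
    hG.mul (continuous_circ_zpow _)
  simp only [e]
  have hre := Complex.reCLM.intervalIntegral_comp_comm (a := 0) (b := 2 * Real.pi)
    (μ := volume) (f := fun x => ∑ i, ∑ j, (v i : ℂ) * v j *
      (genFun α x * circ x ^ (-((i : ℤ) - (j : ℤ) + p)))) (Continuous.intervalIntegrable (by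
        refine continuous_finsetSum _ fun i _ => continuous_finsetSum _ fun j _ => ?_
        exact continuous_const.mul (hc _)) _ _)
  simp only [Complex.reCLM_apply] at hre
  rw [hre, intervalIntegral.integral_finsetSum]
  · have : ∀ i : Fin n, ∫ x in (0 : ℝ)..2 * Real.pi, ∑ j, (v i : ℂ) * v j *
        (genFun α x * circ x ^ (-((i : ℤ) - (j : ℤ) + p))) =
        ((∑ j, v i * v j * (2 * Real.pi * q α ((i : ℤ) - (j : ℤ) + p)) : ℝ) : ℂ) := by
      intro i
      rw [intervalIntegral.integral_finsetSum]
      · push_cast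
        refine Finset.sum_congr rfl fun j _ => ?_
        rw [intervalIntegral.integral_const_mul, integral_genFun_mul hα hα']
      · intro j _
        exact (continuous_const.mul (hc _)).intervalIntegrable _ _
    simp only [this]
    rw [← Complex.ofReal_sum, Complex.ofReal_re]
    simp only [dotProduct, Matrix.mulVec, A1, Matrix.of_apply, Finset.mul_sum]
    refine Finset.sum_congr rfl fun i _ => Finset.sum_congr rfl fun j _ => ?_
    ring
  · intro i _
    refine Continuous.intervalIntegrable ?_ _ _
    exact continuous_finsetSum _ fun j _ => continuous_const.mul (hc _)

/-- A polynomial vanishing on the open upper half circle is zero. The point found is off the real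
axis, where the symbol is strictly negative. -/
lemma exists_trigPoly_ne_zero {v : Fin n → ℝ} (hv : v ≠ 0) :
    ∃ x ∈ Set.Ioo 0 Real.pi, trigPoly v x ≠ 0 := by
  by_contra! h
  let P : Polynomial ℂ := ∑ j, Polynomial.C (v j : ℂ) * Polynomial.X ^ (j : ℕ)
  have heval : ∀ x, P.eval (circ x) = trigPoly v x := by
    intro x
    simp [P, trigPoly, Polynomial.eval_finsetSum]
  have hP : P = 0 := by
    refine Polynomial.eq_zero_of_infinite_isRoot P ?_
    refine Set.Infinite.mono (s := circ '' Set.Ioo 0 Real.pi) ?_ ?_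
    · rintro _ ⟨x, hx, rfl⟩
      exact (heval x).trans (h x hx)
    · refine Set.Infinite.image ?_ (Set.Ioo_infinite Real.pi_pos)
      intro x hx y hy hxy
      have : Real.cos x = Real.cos y := by
        have := congrArg Complex.re hxy
        simpa only [circ, Complex.exp_ofReal_mul_I_re] using this
      exact Real.injOn_cos ⟨hx.1.le, hx.2.le⟩ ⟨hy.1.le, hy.2.le⟩ this
  apply hv
  ext j
  have := congrArg (fun Q => Q.coeff (j : ℕ)) hP
  simp only [P, Polynomial.finsetSum_coeff, Polynomial.coeff_C_mul, Polynomial.coeff_X_pow,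
    Polynomial.coeff_zero] at this
  rw [Finset.sum_eq_single j] at this
  · simpa using this
  · intro i _ hij
    rw [if_neg (fun h => hij (Fin.ext h.symm)), mul_zero]
  · simp

/-- The integral over a period as a linear map on continuous functions. -/
def periodIntegral : C(ℝ, ℝ) →ₗ[ℝ] ℝ where
  toFun f := ∫ x in (0 : ℝ)..2 * Real.pi, f x
  map_add' f h := intervalIntegral.integral_add (f.continuous.intervalIntegrable _ _)
    (h.continuous.intervalIntegrable _ _)
  map_smul' c _ := intervalIntegral.integral_smul c _

/-- Evaluation of a continuous function as a linear map. -/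
def evalLinear (x : ℝ) : C(ℝ, ℝ) →ₗ[ℝ] ℝ where
  toFun f := f x
  map_add' _ _ := rfl
  map_smul' _ _ := rfl

/-- The quadratic form of a matrix at `v`, as a linear function of the matrix. -/
def quadForm (v : Fin n → ℝ) : Matrix (Fin n) (Fin n) ℝ →ₗ[ℝ] ℝ where
  toFun M := v ⬝ᵥ (M *ᵥ v)
  map_add' M N := by rw [Matrix.add_mulVec, dotProduct_add]
  map_smul' c M := by rw [Matrix.smul_mulVec, dotProduct_smul]; rfl

lemma stencil4_congr {S : Shifts} {φ ψ : ℤ → ℝ} (h : ∀ p, φ p = ψ p) :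
    stencil4 α S φ = stencil4 α S ψ := by rw [funext h]

/-- The fourth order Toeplitz matrices are negative definite. -/
theorem A4_neg_def {S : Shifts} (hS : S.Effective) (hα : 1 < α) (hα' : α < 2)
    (hN : S.Nondegenerate α) {v : Fin n → ℝ} (hv : v ≠ 0) : v ⬝ᵥ (A4 α S n *ᵥ v) < 0 := by
  let Φ : ℤ → C(ℝ, ℝ) := fun p => ⟨formIntegrand α v p, continuous_formIntegrand hα hα' v p⟩
  have h1 : 2 * Real.pi * (v ⬝ᵥ (A4 α S n *ᵥ v)) = periodIntegral (stencil4 α S Φ) := by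
    rw [map_stencil4]
    have : v ⬝ᵥ (A4 α S n *ᵥ v) = quadForm v (stencil4 α S (A1 α n)) := rfl
    rw [this, map_stencil4, ← smul_eq_mul, ← LinearMap.lsmul_apply, map_stencil4]
    exact stencil4_congr fun p => (integral_formIntegrand hα hα' v p).symm
  have h2 : ∀ x, Real.sin x ≠ 0 → ∃ c < 0, stencil4 α S Φ x =
      Complex.normSq (trigPoly v x) * c := by
    intro x hx
    have hz : ‖(circ x)⁻¹‖ = 1 := by rw [norm_inv, norm_circ, inv_one]
    have him : (circ x).im ≠ 0 := by rwa [circ_im]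
    have him' : ((circ x)⁻¹).im ≠ 0 := by
      rw [inv_eq_conj_of_norm_eq_one (norm_circ x), Complex.conj_im]
      exact neg_ne_zero.mpr him
    obtain ⟨ρ₁, ρ₂, p1, p2, he, h3⟩ := cpow_eq_combination hα hα' (lubich_im_ne_zero hz him')
    refine ⟨_, stencil4_realSymbol_neg hS hα hα' hN hz him' p1 p2 h3, ?_⟩
    have hg : genFun α x = ρ₁ * lubich (circ x)⁻¹ + ρ₂ * lubich (circ x)⁻¹ ^ 2 := by
      rw [← he]
      exact (hasSum_genFun hα hα' x).unique (hasSum_q hα hα' (norm_circ x) him)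
    have : stencil4 α S Φ x = evalLinear x (stencil4 α S Φ) := rfl
    rw [this, map_stencil4, ← smul_eq_mul (Complex.normSq (trigPoly v x)),
      ← LinearMap.lsmul_apply, map_stencil4]
    refine stencil4_congr fun p => ?_
    change formIntegrand α v p x = Complex.normSq (trigPoly v x) * _
    rw [formIntegrand, hg, realSymbol, add_mul, Complex.add_re, mul_assoc, mul_assoc,
      Complex.re_ofReal_mul, Complex.re_ofReal_mul, inv_zpow, zpow_neg]
  have hnonpos : ∀ x, Real.sin x ≠ 0 → stencil4 α S Φ x ≤ 0 := by
    intro x hx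
    obtain ⟨c, hc, h⟩ := h2 x hx
    rw [h]
    exact mul_nonpos_of_nonneg_of_nonpos (Complex.normSq_nonneg _) hc.le
  -- The sign is known only where `sin x ≠ 0`; continuity extends it, in weak form, to the remaining
  -- points.
  have hcl : IsClosed {x | stencil4 α S Φ x ≤ 0} :=
    isClosed_le (stencil4 α S Φ).continuous continuous_const
  have hpi := Real.pi_pos
  have hle : ∀ x ∈ Set.Ioc 0 (2 * Real.pi), stencil4 α S Φ x ≤ 0 := by
    intro x hx
    rcases le_total x Real.pi with h | h
    · have hsub : Set.Ioo 0 Real.pi ⊆ {x | stencil4 α S Φ x ≤ 0} := fun y hy =>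
        hnonpos y (Real.sin_pos_of_pos_of_lt_pi hy.1 hy.2).ne'
      have := hcl.closure_subset_iff.mpr hsub
      rw [closure_Ioo hpi.ne] at this
      exact this ⟨hx.1.le, h⟩
    · have hsub : Set.Ioo Real.pi (2 * Real.pi) ⊆ {x | stencil4 α S Φ x ≤ 0} := fun y hy =>
        hnonpos y (by
          rw [← neg_ne_zero, ← Real.sin_sub_pi]
          exact (Real.sin_pos_of_pos_of_lt_pi (by linarith [hy.1]) (by linarith [hy.2])).ne')
      have := hcl.closure_subset_iff.mpr hsub
      rw [closure_Ioo (by linarith)] at this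
      exact this ⟨h, hx.2⟩
  obtain ⟨x₀, hx₀, hne⟩ := exists_trigPoly_ne_zero hv
  have h3 : 0 < ∫ x in (0 : ℝ)..2 * Real.pi, -(stencil4 α S Φ x) := by
    refine intervalIntegral.integral_pos (by linarith) (by fun_prop)
      (fun x hx => neg_nonneg.mpr (hle x hx)) ⟨x₀, ⟨hx₀.1.le, by linarith [hx₀.2]⟩, ?_⟩
    obtain ⟨c, hc, h⟩ := h2 x₀ (Real.sin_pos_of_pos_of_lt_pi hx₀.1 hx₀.2).ne'
    rw [h]
    have := mul_neg_of_pos_of_neg (Complex.normSq_pos.mpr hne) hc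
    linarith
  rw [intervalIntegral.integral_neg] at h3
  have h4 : periodIntegral (stencil4 α S Φ) < 0 := neg_pos.mp h3
  rw [← h1] at h4
  exact neg_of_mul_neg_right h4 (by positivity)

end Fourier

/-! ### Energy estimates for Cayley transforms -/

section Energy

variable {ι : Type*} [Fintype ι] {M X Y : Matrix ι ι ℝ}

/-- `X` is dissipative with respect to the bilinear form of `M`. -/
def Dissipative (M X : Matrix ι ι ℝ) : Prop := ∀ v, v ⬝ᵥ ((M * X) *ᵥ v) ≤ 0

/-- `X` is strictly dissipative with respect to the bilinear form of `M`. -/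
def StrictlyDissipative (M X : Matrix ι ι ℝ) : Prop := ∀ v, v ≠ 0 → v ⬝ᵥ ((M * X) *ᵥ v) < 0

lemma StrictlyDissipative.dissipative (h : StrictlyDissipative M X) : Dissipative M X := by
  intro v
  by_cases hv : v = 0
  · simp [hv]
  · exact (h v hv).le

/-- The quadratic form of `M`. -/
def energy (M : Matrix ι ι ℝ) (v : ι → ℝ) : ℝ := v ⬝ᵥ (M *ᵥ v)

lemma dotProduct_mulVec_transpose (M : Matrix ι ι ℝ) (v w : ι → ℝ) :
    v ⬝ᵥ (Mᵀ *ᵥ w) = w ⬝ᵥ (M *ᵥ v) := by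
  rw [Matrix.mulVec_transpose, dotProduct_comm, Matrix.dotProduct_mulVec]

lemma _root_.Matrix.PosDef.dotProduct_mulVec_comm (hM : M.PosDef) (v w : ι → ℝ) :
    v ⬝ᵥ (M *ᵥ w) = w ⬝ᵥ (M *ᵥ v) := by
  have h : Mᵀ = M := by simpa using hM.isHermitian.eq
  rw [← dotProduct_mulVec_transpose, h]

lemma energy_pos (hM : M.PosDef) {v : ι → ℝ} (hv : v ≠ 0) : 0 < energy M v := by
  simpa [energy] using hM.dotProduct_mulVec_pos hv

lemma energy_nonneg (hM : M.PosDef) (v : ι → ℝ) : 0 ≤ energy M v := by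
  by_cases hv : v = 0
  · simp [energy, hv]
  · exact (energy_pos hM hv).le

lemma Dissipative.smul {c : ℝ} (hc : 0 ≤ c) (hX : Dissipative M X) : Dissipative M (c • X) := by
  intro v
  rw [Matrix.mul_smul, Matrix.smul_mulVec, dotProduct_smul]
  exact mul_nonpos_of_nonneg_of_nonpos hc (hX v)

lemma StrictlyDissipative.smul {c : ℝ} (hc : 0 < c) (hX : StrictlyDissipative M X) :
    StrictlyDissipative M (c • X) := by
  intro v hv
  rw [Matrix.mul_smul, Matrix.smul_mulVec, dotProduct_smul]
  exact mul_neg_of_pos_of_neg hc (hX v hv)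

variable [DecidableEq ι]

/-- By symmetry of `M` the even terms cancel and the cross terms agree. -/
lemma energy_add_sub (hM : M.PosDef) (X : Matrix ι ι ℝ) (v : ι → ℝ) :
    energy M ((1 + X) *ᵥ v) - energy M ((1 - X) *ᵥ v) = 4 * (v ⬝ᵥ ((M * X) *ᵥ v)) := by
  have h := hM.dotProduct_mulVec_comm (X *ᵥ v) v
  simp only [energy, Matrix.add_mulVec, Matrix.sub_mulVec, Matrix.one_mulVec, Matrix.mulVec_add,
    Matrix.mulVec_sub, dotProduct_add, dotProduct_sub, add_dotProduct, sub_dotProduct,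
    ← Matrix.mulVec_mulVec]
  linarith

lemma Dissipative.energy_le (hX : Dissipative M X) (hM : M.PosDef) (v : ι → ℝ) :
    energy M ((1 + X) *ᵥ v) ≤ energy M ((1 - X) *ᵥ v) := by
  linarith [energy_add_sub hM X v, hX v]

lemma StrictlyDissipative.energy_lt (hX : StrictlyDissipative M X) (hM : M.PosDef) {v : ι → ℝ}
    (hv : v ≠ 0) : energy M ((1 + X) *ᵥ v) < energy M ((1 - X) *ᵥ v) := by
  linarith [energy_add_sub hM X v, hX v hv]

lemma Dissipative.isUnit_one_sub (hX : Dissipative M X) (hM : M.PosDef) : IsUnit (1 - X) := by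
  rw [← Matrix.mulVec_injective_iff_isUnit, ← Matrix.coe_mulVecLin,
    injective_iff_map_eq_zero]
  intro v hv
  rw [Matrix.mulVecLin_apply] at hv
  by_contra hne
  have hXv : X *ᵥ v = v := by
    rw [Matrix.sub_mulVec, Matrix.one_mulVec, sub_eq_zero] at hv
    exact hv.symm
  have h := hX v
  rw [← Matrix.mulVec_mulVec, hXv] at h
  exact absurd (energy_pos hM hne) (not_lt.mpr h)

lemma commute_one_add_one_sub {R : Type*} [Ring R] {a b : R} (h : Commute a b) :
    Commute (1 + a) (1 - b) :=
  (Commute.one_left _).add_left ((Commute.one_right a).sub_right h)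

/-- A solution of `(1 - X) (1 - Y) u' = (1 + X) (1 + Y) u` has the form
`u = (1 - X) (1 - Y) r`, `u' = (1 + X) (1 + Y) r`. -/
lemma exists_cayley_factor (hM : M.PosDef) (hX : Dissipative M X) (hY : Dissipative M Y)
    (hc : Commute X Y) {u u' : ι → ℝ}
    (h : ((1 - X) * (1 - Y)) *ᵥ u' = ((1 + X) * (1 + Y)) *ᵥ u) :
    ∃ r, u = ((1 - X) * (1 - Y)) *ᵥ r ∧ u' = ((1 + X) * (1 + Y)) *ᵥ r := by
  have hU : IsUnit ((1 - X) * (1 - Y)) := (hX.isUnit_one_sub hM).mul (hY.isUnit_one_sub hM)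
  have hcomm : Commute ((1 + X) * (1 + Y)) ((1 - X) * (1 - Y)) :=
    Commute.mul_left
      ((commute_one_add_one_sub (Commute.refl X)).mul_right (commute_one_add_one_sub hc))
      ((commute_one_add_one_sub hc.symm).mul_right (commute_one_add_one_sub (Commute.refl Y)))
  obtain ⟨r, hr⟩ := (Matrix.mulVec_surjective_iff_isUnit.mpr hU) u
  refine ⟨r, hr.symm, Matrix.mulVec_injective_iff_isUnit.mpr hU ?_⟩
  change ((1 - X) * (1 - Y)) *ᵥ u' = ((1 - X) * (1 - Y)) *ᵥ _
  rw [h, ← hr, Matrix.mulVec_mulVec, Matrix.mulVec_mulVec, hcomm.eq]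

lemma energy_step_le (hM : M.PosDef) (hX : Dissipative M X) (hY : Dissipative M Y)
    (hc : Commute X Y) {u u' : ι → ℝ}
    (h : ((1 - X) * (1 - Y)) *ᵥ u' = ((1 + X) * (1 + Y)) *ᵥ u) : energy M u' ≤ energy M u := by
  obtain ⟨r, rfl, rfl⟩ := exists_cayley_factor hM hX hY hc h
  calc energy M (((1 + X) * (1 + Y)) *ᵥ r)
      = energy M ((1 + X) *ᵥ ((1 + Y) *ᵥ r)) := by rw [Matrix.mulVec_mulVec]
    _ ≤ energy M ((1 - X) *ᵥ ((1 + Y) *ᵥ r)) := hX.energy_le hM _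
    _ = energy M ((1 + Y) *ᵥ ((1 - X) *ᵥ r)) := by
      rw [Matrix.mulVec_mulVec, Matrix.mulVec_mulVec, (commute_one_add_one_sub hc.symm).eq]
    _ ≤ energy M ((1 - Y) *ᵥ ((1 - X) *ᵥ r)) := hY.energy_le hM _
    _ = energy M (((1 - X) * (1 - Y)) *ᵥ r) := by
      rw [Matrix.mulVec_mulVec,
        (((Commute.one_left _).sub_left ((Commute.one_right Y).sub_right hc.symm) :
          Commute (1 - Y) (1 - X))).eq]

/-- Strictness of one of the two factors suffices: `1 - X` is injective on the vector `r` that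
matters, so the strict factor acts on a nonzero vector. -/
lemma energy_step_lt (hM : M.PosDef) (hX : Dissipative M X) (hY : StrictlyDissipative M Y)
    (hc : Commute X Y) {u u' : ι → ℝ} (hu : u ≠ 0)
    (h : ((1 - X) * (1 - Y)) *ᵥ u' = ((1 + X) * (1 + Y)) *ᵥ u) : energy M u' < energy M u := by
  obtain ⟨r, rfl, rfl⟩ := exists_cayley_factor hM hX hY.dissipative hc h
  have hXY : Commute (1 - Y) (1 - X) :=
    (Commute.one_left _).sub_left ((Commute.one_right Y).sub_right hc.symm)
  have hr : (1 - X) *ᵥ r ≠ 0 := by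
    intro h0
    apply hu
    rw [← hXY.eq, ← Matrix.mulVec_mulVec, h0, Matrix.mulVec_zero]
  calc energy M (((1 + X) * (1 + Y)) *ᵥ r)
      = energy M ((1 + X) *ᵥ ((1 + Y) *ᵥ r)) := by rw [Matrix.mulVec_mulVec]
    _ ≤ energy M ((1 - X) *ᵥ ((1 + Y) *ᵥ r)) := hX.energy_le hM _
    _ = energy M ((1 + Y) *ᵥ ((1 - X) *ᵥ r)) := by
      rw [Matrix.mulVec_mulVec, Matrix.mulVec_mulVec, (commute_one_add_one_sub hc.symm).eq]
    _ < energy M ((1 - Y) *ᵥ ((1 - X) *ᵥ r)) := hY.energy_lt hM hr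
    _ = energy M (((1 - X) * (1 - Y)) *ᵥ r) := by rw [Matrix.mulVec_mulVec, hXY.eq]

/-- The form of a positive definite matrix is comparable to the Euclidean one. -/
lemma exists_energy_bounds (hM : M.PosDef) :
    ∃ m m' : ℝ, 0 < m ∧ ∀ v, m * (v ⬝ᵥ v) ≤ energy M v ∧ energy M v ≤ m' * (v ⬝ᵥ v) := by
  let S : Set (ι → ℝ) := {v | v ⬝ᵥ v = 1}
  have hcont : Continuous (energy M) := by
    unfold energy
    simp only [dotProduct, Matrix.mulVec]
    fun_prop
  have hScl : IsClosed S := isClosed_eq (by simp only [dotProduct]; fun_prop) continuous_const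
  have hS : IsCompact S := by
    refine Metric.isCompact_of_isClosed_isBounded hScl
      (Metric.isBounded_closedBall (x := (0 : ι → ℝ)) (r := 1) |>.subset fun v hv => ?_)
    rw [mem_closedBall_zero_iff, pi_norm_le_iff_of_nonneg zero_le_one]
    intro i
    have hv : ∑ j, v j * v j = 1 := hv
    have : v i * v i ≤ 1 := by
      rw [← hv]
      exact Finset.single_le_sum (f := fun j => v j * v j) (fun j _ => mul_self_nonneg _)
        (Finset.mem_univ i)
    rw [Real.norm_eq_abs]
    exact abs_le_one_iff_mul_self_le_one.mpr this
  have hscale : ∀ v : ι → ℝ, v ≠ 0 → 0 < v ⬝ᵥ v ∧ ∃ w ∈ S, energy M v = energy M w * (v ⬝ᵥ v) := by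
    intro v hv
    have hpos : 0 < v ⬝ᵥ v := by
      have := (Matrix.PosDef.one (n := ι) (R := ℝ)).dotProduct_mulVec_pos hv
      simpa using this
    have hs := Real.sq_sqrt hpos.le
    have hs0 : 0 < √(v ⬝ᵥ v) := Real.sqrt_pos.mpr hpos
    refine ⟨hpos, (√(v ⬝ᵥ v))⁻¹ • v, ?_, ?_⟩
    · change ((√(v ⬝ᵥ v))⁻¹ • v) ⬝ᵥ ((√(v ⬝ᵥ v))⁻¹ • v) = 1
      rw [smul_dotProduct, dotProduct_smul, smul_eq_mul, smul_eq_mul]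
      field_simp
      exact hs.symm
    · simp only [energy, Matrix.mulVec_smul, smul_dotProduct, dotProduct_smul, smul_eq_mul]
      field_simp
      rw [hs]
  have hzero : ∀ c : ℝ, c * ((0 : ι → ℝ) ⬝ᵥ 0) = 0 ∧ energy M 0 = 0 := fun c => by
    simp [energy]
  -- The sphere is empty exactly when there are no indices, as on a grid with a single cell in some
  -- direction.
  rcases S.eq_empty_or_nonempty with hE | hE
  · refine ⟨1, 1, one_pos, fun v => ?_⟩
    have hv : v = 0 := by
      by_contra hv
      obtain ⟨-, w, hw, -⟩ := hscale v hv
      rw [hE] at hw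
      exact hw
    rw [hv, (hzero 1).1, (hzero 1).2]
    exact ⟨le_rfl, le_rfl⟩
  · obtain ⟨a, ha, hmin⟩ := hS.exists_isMinOn hE hcont.continuousOn
    obtain ⟨b, hb, hmax⟩ := hS.exists_isMaxOn hE hcont.continuousOn
    refine ⟨energy M a, energy M b, energy_pos hM ?_, fun v => ?_⟩
    · rintro rfl
      have : (0 : ι → ℝ) ⬝ᵥ 0 = 1 := ha
      simp at this
    · by_cases hv : v = 0
      · rw [hv, (hzero _).1, (hzero 0).2, (hzero _).1]
        exact ⟨le_rfl, le_rfl⟩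
      · obtain ⟨hpos, w, hw, e⟩ := hscale v hv
        rw [e]
        exact ⟨mul_le_mul_of_nonneg_right (hmin hw) hpos.le,
          mul_le_mul_of_nonneg_right (hmax hw) hpos.le⟩

attribute [local instance] Matrix.linftyOpNormedRing Matrix.linftyOpNormedAlgebra

/-- A real matrix which strictly decreases a positive definite form has spectral radius less
than one. -/
lemma spectralRadius_lt_one (hM : M.PosDef) {C : Matrix ι ι ℝ}
    (hC : ∀ v, v ≠ 0 → energy M (C *ᵥ v) < energy M v) :
    spectralRadius ℂ (C.map (fun t : ℝ => (t : ℂ))) < 1 := by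
  set A : Matrix ι ι ℂ := C.map (fun t : ℝ => (t : ℂ)) with hA
  rcases (spectrum ℂ A).eq_empty_or_nonempty with hE | hE
  · simp [spectralRadius, hE]
  have : CompleteSpace (Matrix ι ι ℂ) := FiniteDimensional.complete ℂ _
  refine spectrum.spectralRadius_lt_of_forall_lt_of_nonempty hE (r := 1) fun k hk => ?_
  rw [spectrum.mem_iff, Matrix.isUnit_iff_isUnit_det, isUnit_iff_ne_zero, not_not,
    ← Matrix.exists_mulVec_eq_zero_iff] at hk
  obtain ⟨w, hw, hkw⟩ := hk
  rw [Matrix.sub_mulVec, sub_eq_zero, Algebra.algebraMap_eq_smul_one, Matrix.smul_mulVec,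
    Matrix.one_mulVec] at hkw
  set a : ι → ℝ := fun i => (w i).re with ha
  set b : ι → ℝ := fun i => (w i).im with hb
  have hCa : C *ᵥ a = k.re • a - k.im • b := by
    ext i
    have := congrArg Complex.re (congrFun hkw i)
    simp only [Pi.smul_apply, smul_eq_mul, Complex.mul_re, Matrix.mulVec, dotProduct, hA,
      Matrix.map_apply, Complex.re_sum, Complex.ofReal_re, Complex.ofReal_im, zero_mul,
      sub_zero] at this
    simp only [Matrix.mulVec, dotProduct, ha, hb, Pi.sub_apply, Pi.smul_apply, smul_eq_mul, this]
  have hCb : C *ᵥ b = k.re • b + k.im • a := by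
    ext i
    have := congrArg Complex.im (congrFun hkw i)
    simp only [Pi.smul_apply, smul_eq_mul, Complex.mul_im, Matrix.mulVec, dotProduct, hA,
      Matrix.map_apply, Complex.im_sum, Complex.ofReal_re, Complex.ofReal_im, zero_mul,
      add_zero] at this
    simp only [Matrix.mulVec, dotProduct, ha, hb, Pi.add_apply, Pi.smul_apply, smul_eq_mul, this]
  -- On the real and imaginary parts of an eigenvector `C` acts as a rotation scaled by `‖k‖`; the
  -- cross terms cancel in the sum of the two energies.
  have hsum : energy M (C *ᵥ a) + energy M (C *ᵥ b) =
      (k.re ^ 2 + k.im ^ 2) * (energy M a + energy M b) := by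
    have h := hM.dotProduct_mulVec_comm a b
    rw [hCa, hCb]
    simp only [energy, Matrix.mulVec_add, Matrix.mulVec_sub, Matrix.mulVec_smul, dotProduct_add,
      dotProduct_sub, add_dotProduct, sub_dotProduct, smul_dotProduct, dotProduct_smul,
      smul_eq_mul]
    ring
  have hab : a ≠ 0 ∨ b ≠ 0 := by
    by_contra! h
    apply hw
    ext i
    exact Complex.ext (congrFun h.1 i) (congrFun h.2 i)
  have hle : ∀ v, energy M (C *ᵥ v) ≤ energy M v := fun v => by
    by_cases hv : v = 0
    · simp [hv]
    · exact (hC v hv).le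
  have hlt : (k.re ^ 2 + k.im ^ 2) * (energy M a + energy M b) < energy M a + energy M b := by
    rw [← hsum]
    rcases hab with h | h
    · exact add_lt_add_of_lt_of_le (hC a h) (hle b)
    · exact add_lt_add_of_le_of_lt (hle a) (hC b h)
  have hpos : 0 < energy M a + energy M b := by
    rcases hab with h | h
    · exact add_pos_of_pos_of_nonneg (energy_pos hM h) (energy_nonneg hM b)
    · exact add_pos_of_nonneg_of_pos (energy_nonneg hM a) (energy_pos hM h)
  have hk1 : k.re ^ 2 + k.im ^ 2 < 1 := by
    by_contra! h
    nlinarith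
  rw [← NNReal.coe_lt_coe, coe_nnnorm, NNReal.coe_one]
  have hn : ‖k‖ ^ 2 = k.re ^ 2 + k.im ^ 2 := by
    rw [← Complex.normSq_eq_norm_sq, Complex.normSq_apply]; ring
  nlinarith [norm_nonneg k]

end Energy

/-! ### Dissipativity under Kronecker products -/

section Kronecker

variable {ι κ : Type*} {P : Matrix ι ι ℝ} {N : Matrix κ κ ℝ}

lemma kronecker_symmetrize_right (hP : P.PosDef) (N : Matrix κ κ ℝ) :
    P ⊗ₖ (-(N + Nᵀ)) = -(P ⊗ₖ N + (P ⊗ₖ N)ᵀ) := by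
  have h : Pᵀ = P := by simpa using hP.isHermitian.eq
  ext ⟨i, j⟩ ⟨k, l⟩
  have h' : P k i = P i k := congrFun (congrFun h i) k
  simp [Matrix.kroneckerMap_apply, h']
  ring

lemma kronecker_symmetrize_left (hP : P.PosDef) (N : Matrix κ κ ℝ) :
    (-(N + Nᵀ)) ⊗ₖ P = -(N ⊗ₖ P + (N ⊗ₖ P)ᵀ) := by
  have h : Pᵀ = P := by simpa using hP.isHermitian.eq
  ext ⟨i, j⟩ ⟨k, l⟩
  have h' : P l j = P j l := congrFun (congrFun h j) l
  simp [Matrix.kroneckerMap_apply, h']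
  ring

variable [Fintype ι] [Fintype κ]

lemma dotProduct_symmetrize (N : Matrix κ κ ℝ) (v : κ → ℝ) :
    v ⬝ᵥ ((-(N + Nᵀ)) *ᵥ v) = -2 * (v ⬝ᵥ (N *ᵥ v)) := by
  rw [Matrix.neg_mulVec, Matrix.add_mulVec, dotProduct_neg, dotProduct_add,
    dotProduct_mulVec_transpose]
  ring

lemma posSemidef_symmetrize (hN : ∀ v, v ⬝ᵥ (N *ᵥ v) ≤ 0) : (-(N + Nᵀ)).PosSemidef := by
  refine Matrix.PosSemidef.of_dotProduct_mulVec_nonneg ?_ fun v => ?_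
  · rw [Matrix.IsHermitian, Matrix.conjTranspose_eq_transpose_of_trivial]
    simp [add_comm]
  · rw [star_trivial, dotProduct_symmetrize]
    linarith [hN v]

lemma posDef_symmetrize (hN : ∀ v, v ≠ 0 → v ⬝ᵥ (N *ᵥ v) < 0) : (-(N + Nᵀ)).PosDef := by
  refine Matrix.PosDef.of_dotProduct_mulVec_pos ?_ fun v hv => ?_
  · rw [Matrix.IsHermitian, Matrix.conjTranspose_eq_transpose_of_trivial]
    simp [add_comm]
  · rw [star_trivial, dotProduct_symmetrize]
    linarith [hN v hv]

variable [DecidableEq ι]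

/-- The symmetric part of `P ⊗ N` is `P` tensored with that of `N`, because `P` is symmetric;
Kronecker products preserve semidefiniteness. -/
lemma Dissipative.kronecker_right {M B : Matrix κ κ ℝ} (hP : P.PosDef) (h : Dissipative M B) :
    Dissipative (P ⊗ₖ M) ((1 : Matrix ι ι ℝ) ⊗ₖ B) := by
  intro v
  rw [← Matrix.mul_kronecker_mul, mul_one]
  have h1 := (hP.posSemidef.kronecker (posSemidef_symmetrize h)).dotProduct_mulVec_nonneg v
  rw [kronecker_symmetrize_right hP, star_trivial, dotProduct_symmetrize] at h1
  linarith

lemma Dissipative.kronecker_left {M B : Matrix κ κ ℝ} (hP : P.PosDef) (h : Dissipative M B) :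
    Dissipative (M ⊗ₖ P) (B ⊗ₖ (1 : Matrix ι ι ℝ)) := by
  intro v
  rw [← Matrix.mul_kronecker_mul, mul_one]
  have h1 := ((posSemidef_symmetrize h).kronecker hP.posSemidef).dotProduct_mulVec_nonneg v
  rw [kronecker_symmetrize_left hP, star_trivial, dotProduct_symmetrize] at h1
  linarith

lemma StrictlyDissipative.kronecker_left {M B : Matrix κ κ ℝ} (hP : P.PosDef)
    (h : StrictlyDissipative M B) :
    StrictlyDissipative (M ⊗ₖ P) (B ⊗ₖ (1 : Matrix ι ι ℝ)) := by
  intro v hv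
  rw [← Matrix.mul_kronecker_mul, mul_one]
  have h1 := ((posDef_symmetrize h).kronecker hP).dotProduct_mulVec_pos hv
  rw [kronecker_symmetrize_left hP, star_trivial, dotProduct_symmetrize] at h1
  linarith

end Kronecker

/-! ### Weights for a diagonal times a negative definite matrix -/

section DiagonalScaling

variable {ι : Type*} [DecidableEq ι] {d : ι → ℝ}

lemma posDef_diagonal_inv (hd : ∀ i, 0 < d i) : (Matrix.diagonal fun i => (d i)⁻¹).PosDef :=
  Matrix.PosDef.diagonal fun i => inv_pos.mpr (hd i)

variable [Fintype ι] {H : Matrix ι ι ℝ}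

/-- A positive definite matrix for which `diagonal d * H` is dissipative, if `d ≥ 0` and `H` is
negative definite. -/
def degenerateWeight (d : ι → ℝ) (H : Matrix ι ι ℝ) : Matrix ι ι ℝ :=
  Hᵀ * Matrix.diagonal d * H + Matrix.diagonal fun i => if d i = 0 then 1 else 0

lemma dotProduct_degenerateWeight (d : ι → ℝ) (H : Matrix ι ι ℝ) (v w : ι → ℝ) :
    v ⬝ᵥ (degenerateWeight d H *ᵥ w) =
      (∑ i, d i * (H *ᵥ v) i * (H *ᵥ w) i) + ∑ i, (if d i = 0 then 1 else 0) * v i * w i := by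
  rw [degenerateWeight, Matrix.add_mulVec, dotProduct_add, ← Matrix.mulVec_mulVec,
    ← Matrix.mulVec_mulVec, dotProduct_mulVec_transpose, dotProduct_comm]
  simp only [dotProduct, Matrix.mulVec_diagonal]
  congr 1 <;> refine Finset.sum_congr rfl fun i _ => by ring

/-- If the form vanishes at `v`, then `v i = 0` where `d i = 0` and `(H v) i = 0` elsewhere. Hence
`v ⬝ᵥ H v = 0`, which forces `v = 0`. -/
lemma posDef_degenerateWeight (hd : ∀ i, 0 ≤ d i) (hH : ∀ v, v ≠ 0 → v ⬝ᵥ (H *ᵥ v) < 0) :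
    (degenerateWeight d H).PosDef := by
  refine Matrix.PosDef.of_dotProduct_mulVec_pos ?_ fun v hv => ?_
  · rw [Matrix.IsHermitian, Matrix.conjTranspose_eq_transpose_of_trivial, degenerateWeight]
    simp [Matrix.transpose_mul, Matrix.mul_assoc]
  · rw [star_trivial, dotProduct_degenerateWeight]
    have h1 : ∀ i ∈ Finset.univ, 0 ≤ d i * (H *ᵥ v) i * (H *ᵥ v) i := fun i _ => by
      rw [mul_assoc]; exact mul_nonneg (hd i) (mul_self_nonneg _)
    have h2 : ∀ i ∈ Finset.univ, 0 ≤ (if d i = 0 then 1 else 0) * v i * v i := fun i _ => by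
      rw [mul_assoc]; exact mul_nonneg (by split_ifs <;> norm_num) (mul_self_nonneg _)
    refine lt_of_le_of_ne (add_nonneg (Finset.sum_nonneg h1) (Finset.sum_nonneg h2)) fun h0 => ?_
    have h3 := (add_eq_zero_iff_of_nonneg (Finset.sum_nonneg h1) (Finset.sum_nonneg h2)).mp h0.symm
    have h4 := (Finset.sum_eq_zero_iff_of_nonneg h1).mp h3.1
    have h5 := (Finset.sum_eq_zero_iff_of_nonneg h2).mp h3.2
    refine (hH v hv).ne (Finset.sum_eq_zero fun i _ => ?_)
    by_cases hdi : d i = 0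
    · have := h5 i (Finset.mem_univ i)
      simp only [hdi, if_true, one_mul, mul_self_eq_zero] at this
      rw [this, zero_mul]
    · have := h4 i (Finset.mem_univ i)
      rw [mul_assoc, mul_eq_zero, mul_self_eq_zero] at this
      rw [this.resolve_left hdi, mul_zero]

/-- With `w = D H v` the first summand of the weight gives `w ⬝ᵥ H w`, and the second gives zero
because `w` vanishes where `d` does. -/
lemma dissipative_degenerateWeight (hH : ∀ v, v ≠ 0 → v ⬝ᵥ (H *ᵥ v) < 0) :
    Dissipative (degenerateWeight d H) (Matrix.diagonal d * H) := by
  intro v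
  rw [← Matrix.mulVec_mulVec, dotProduct_degenerateWeight]
  set w := (Matrix.diagonal d * H) *ᵥ v with hw
  have hwi : ∀ i, w i = d i * (H *ᵥ v) i := fun i => by
    rw [hw, ← Matrix.mulVec_mulVec, Matrix.mulVec_diagonal]
  have h2 : ∑ i, (if d i = 0 then 1 else 0) * v i * w i = 0 :=
    Finset.sum_eq_zero fun i _ => by
      rw [hwi]; split_ifs with h <;> simp [h]
  rw [h2, add_zero]
  have h1 : ∑ i, d i * (H *ᵥ v) i * (H *ᵥ w) i = w ⬝ᵥ (H *ᵥ w) :=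
    Finset.sum_congr rfl fun i _ => by rw [hwi]
  rw [h1]
  by_cases h0 : w = 0
  · simp [h0]
  · exact (hH w h0).le

lemma strictlyDissipative_diagonal_inv (hd : ∀ i, 0 < d i)
    (hH : ∀ v, v ≠ 0 → v ⬝ᵥ (H *ᵥ v) < 0) :
    StrictlyDissipative (Matrix.diagonal fun i => (d i)⁻¹) (Matrix.diagonal d * H) := by
  intro v hv
  have : (Matrix.diagonal fun i => (d i)⁻¹) * (Matrix.diagonal d * H) = H := by
    rw [← Matrix.mul_assoc, Matrix.diagonal_mul_diagonal]
    have : (fun i => (d i)⁻¹ * d i) = fun _ => 1 := funext fun i => inv_mul_cancel₀ (hd i).ne'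
    rw [this, Matrix.diagonal_one, Matrix.one_mul]
  rw [this]
  exact hH v hv

end DiagonalScaling

/-! ### Stability of the factored scheme -/

section TwoSided

variable {α κ : ℝ} {S : Shifts} {n : ℕ}

/-- The two-sided matrix `A_α + κ A_αᵀ`. -/
def twoSided (α κ : ℝ) (S : Shifts) (n : ℕ) : Matrix (Fin n) (Fin n) ℝ :=
  A4 α S n + κ • (A4 α S n)ᵀ

lemma twoSided_neg_def (hS : S.Effective) (hα : 1 < α ∧ α < 2) (hN : S.Nondegenerate α)
    (hκ : 0 ≤ κ) (v : Fin n → ℝ) (hv : v ≠ 0) : v ⬝ᵥ (twoSided α κ S n *ᵥ v) < 0 := by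
  have h := A4_neg_def hS hα.1 hα.2 hN hv
  rw [twoSided, Matrix.add_mulVec, dotProduct_add, Matrix.smul_mulVec, dotProduct_smul,
    dotProduct_mulVec_transpose, smul_eq_mul]
  nlinarith

lemma gridPoint_mem_Ioo {L R : ℝ} (h : L < R) {N : ℕ} (i : Fin (N - 1)) :
    gridPoint L R N i ∈ Set.Ioo L R := by
  have hi : (i : ℕ) + 1 < N := by omega
  have hi' : ((i : ℕ) : ℝ) + 1 < N := by exact_mod_cast hi
  have hN : (0 : ℝ) < N := lt_of_le_of_lt (by positivity) hi'
  have hw : 0 < R - L := sub_pos.mpr h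
  have e : (N : ℝ) * ((R - L) / N) = R - L := by field_simp
  have hs : 0 < (R - L) / N := div_pos hw hN
  unfold gridPoint
  constructor
  · have : 0 < (((i : ℕ) : ℝ) + 1) * ((R - L) / N) := by positivity
    linarith
  · have := mul_lt_mul_of_pos_right hi' hs
    linarith

end TwoSided

namespace Problem

variable {P : Problem} {Nx Ny : ℕ} {τ : ℝ}

/-- The values of `d₊` at the interior nodes. -/
def dGrid (P : Problem) (Nx : ℕ) (i : Fin (Nx - 1)) : ℝ := P.dPlus (gridPoint P.xL P.xR Nx i)

/-- The values of `e₊` at the interior nodes. -/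
def eGrid (P : Problem) (Ny : ℕ) (j : Fin (Ny - 1)) : ℝ := P.ePlus (gridPoint P.yL P.yR Ny j)

lemma calAx_eq {κ : ℝ} (h : P.DMinus Nx = κ • P.DPlus Nx) : P.calAx Nx Ny τ =
    (τ / (2 * ((P.xR - P.xL) / Nx) ^ P.α)) • ((1 : Matrix (Fin (Ny - 1)) (Fin (Ny - 1)) ℝ) ⊗ₖ
      (Matrix.diagonal (P.dGrid Nx) * twoSided P.α κ P.shifts (Nx - 1))) := by
  rw [calAx, h, Matrix.smul_mul, ← Matrix.mul_smul, ← Matrix.mul_add]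
  rfl

lemma calAy_eq {κ : ℝ} (h : P.EMinus Ny = κ • P.EPlus Ny) : P.calAy Nx Ny τ =
    (τ / (2 * ((P.yR - P.yL) / Ny) ^ P.β)) •
      ((Matrix.diagonal (P.eGrid Ny) * twoSided P.β κ P.shifts (Ny - 1)) ⊗ₖ
        (1 : Matrix (Fin (Nx - 1)) (Fin (Nx - 1)) ℝ)) := by
  rw [calAy, h, Matrix.smul_mul, ← Matrix.mul_smul, ← Matrix.mul_add]
  rfl

/-- The two operators act on different tensor factors, since each coefficient depends on its own
variable only. -/
lemma commute_calAx_calAy (P : Problem) (Nx Ny : ℕ) (τ : ℝ) :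
    Commute (P.calAx Nx Ny τ) (P.calAy Nx Ny τ) := by
  unfold calAx calAy
  refine Commute.smul_left (Commute.smul_right ?_ _) _
  rw [commute_iff_eq, ← Matrix.mul_kronecker_mul, ← Matrix.mul_kronecker_mul]
  simp only [mul_one, one_mul]

lemma coeff_pos {L R γ : ℝ} (h : L < R) {N : ℕ} (hN : 0 < N) (hτ : 0 < τ) :
    0 < τ / (2 * ((R - L) / N) ^ γ) := by
  have hw : 0 < R - L := sub_pos.mpr h
  have hN' : (0 : ℝ) < N := by exact_mod_cast hN
  positivity

lemma stableWith_of_dissipative {M : Matrix (Node Nx Ny) (Node Nx Ny) ℝ} (hM : M.PosDef)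
    (hX : Dissipative M (P.calAx Nx Ny τ)) (hY : Dissipative M (P.calAy Nx Ny τ)) {m m' : ℝ}
    (hm : 0 < m) (hb : ∀ v, m * (v ⬝ᵥ v) ≤ energy M v ∧ energy M v ≤ m' * (v ⬝ᵥ v)) :
    P.StableWith Nx Ny τ √(m' / m) := by
  intro Nt F U V hU hV n hn
  have hE : ∀ k ≤ Nt, energy M (V k - U k) ≤ energy M (V 0 - U 0) := by
    intro k
    induction k with
    | zero => exact fun _ => le_rfl
    | succ k ih =>
      intro hk
      refine (energy_step_le hM hX hY (P.commute_calAx_calAy Nx Ny τ) ?_).trans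
        (ih (Nat.le_of_succ_le hk))
      have h1 := hU k hk
      have h2 := hV k hk
      change P.implicitMatrix Nx Ny τ *ᵥ _ = P.explicitMatrix Nx Ny τ *ᵥ _
      rw [Matrix.mulVec_sub, Matrix.mulVec_sub, h1, h2]
      abel
  have hnorm : ∀ v : Node Nx Ny → ℝ, v ⬝ᵥ v = ‖WithLp.toLp 2 v‖ ^ 2 := fun v => by
    rw [EuclideanSpace.real_norm_sq_eq]
    exact Finset.sum_congr rfl fun i _ => (sq (v i)).symm
  have h := ((hb (V n - U n)).1.trans (hE n hn)).trans (hb (V 0 - U 0)).2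
  rw [hnorm, hnorm] at h
  rw [← Real.sqrt_sq (norm_nonneg (WithLp.toLp 2 (V n - U n))),
    ← Real.sqrt_sq (norm_nonneg (WithLp.toLp 2 (V 0 - U 0))), ← Real.sqrt_mul' _ (sq_nonneg _)]
  refine Real.sqrt_le_sqrt ?_
  rw [div_mul_eq_mul_div, le_div_iff₀ hm]
  linarith

lemma spectralRadius_amplification_lt_one {M : Matrix (Node Nx Ny) (Node Nx Ny) ℝ}
    (hM : M.PosDef) (hX : Dissipative M (P.calAx Nx Ny τ))
    (hY : StrictlyDissipative M (P.calAy Nx Ny τ)) :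
    spectralRadius ℂ ((P.amplification Nx Ny τ).map (fun t : ℝ => (t : ℂ))) < 1 := by
  refine spectralRadius_lt_one hM fun v hv =>
    energy_step_lt hM hX hY (P.commute_calAx_calAy Nx Ny τ) hv ?_
  change P.implicitMatrix Nx Ny τ *ᵥ _ = P.explicitMatrix Nx Ny τ *ᵥ _
  have hU : IsUnit (P.implicitMatrix Nx Ny τ) :=
    (hX.isUnit_one_sub hM).mul (hY.dissipative.isUnit_one_sub hM)
  rw [amplification, Matrix.mulVec_mulVec, ← Matrix.mul_assoc,
    Matrix.mul_nonsing_inv _ ((Matrix.isUnit_iff_isUnit_det _).mp hU), Matrix.one_mul]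

lemma energy_diagonal_bounds {ι : Type*} [Fintype ι] [DecidableEq ι] {w : ι → ℝ} {m m' : ℝ}
    (hw : ∀ i, m ≤ w i ∧ w i ≤ m') (v : ι → ℝ) :
    m * (v ⬝ᵥ v) ≤ energy (Matrix.diagonal w) v ∧
      energy (Matrix.diagonal w) v ≤ m' * (v ⬝ᵥ v) := by
  have e : energy (Matrix.diagonal w) v = ∑ i, w i * (v i * v i) := by
    simp only [energy, dotProduct, Matrix.mulVec_diagonal]
    exact Finset.sum_congr rfl fun i _ => by ring
  rw [e, dotProduct, Finset.mul_sum, Finset.mul_sum]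
  exact ⟨Finset.sum_le_sum fun i _ => mul_le_mul_of_nonneg_right (hw i).1 (mul_self_nonneg _),
    Finset.sum_le_sum fun i _ => mul_le_mul_of_nonneg_right (hw i).2 (mul_self_nonneg _)⟩

end Problem

end WSLD

end

theorem theorem4p5 (P : WSLD.Problem)
    (hα : 1 < P.α ∧ P.α < 2) (hβ : 1 < P.β ∧ P.β < 2)
    (hx : P.xL < P.xR) (hy : P.yL < P.yR)
    (hS : P.shifts.Effective)
    (hSα : P.shifts.Nondegenerate P.α) (hSβ : P.shifts.Nondegenerate P.β)
    (hd : ∀ x ∈ Set.Ioo P.xL P.xR, 0 ≤ P.dPlus x)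
    (he : ∀ y ∈ Set.Ioo P.yL P.yR, 0 ≤ P.ePlus y)
    (κα κβ : ℝ) (hκα : 0 ≤ κα) (hκβ : 0 ≤ κβ)
    (hD : ∀ Nx : ℕ, P.DMinus Nx = κα • P.DPlus Nx)
    (hE : ∀ Ny : ℕ, P.EMinus Ny = κβ • P.EPlus Ny) :
    -- the scheme is uniquely solvable, for all step sizes
    (∀ Nx Ny : ℕ, 0 < Nx → 0 < Ny → ∀ τ : ℝ, 0 < τ → IsUnit (P.implicitMatrix Nx Ny τ)) ∧
    -- on every spatial grid it is stable, with a constant independent of the time step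
    (∀ Nx Ny : ℕ, 0 < Nx → 0 < Ny → ∃ K : ℝ, ∀ τ : ℝ, 0 < τ → P.StableWith Nx Ny τ K) ∧
    -- if the coefficients are positive at the grid points, the spectral radius is less than one
    (∀ Nx Ny : ℕ, 0 < Nx → 0 < Ny →
      (∀ i : Fin (Nx - 1), 0 < P.dPlus (WSLD.gridPoint P.xL P.xR Nx i)) →
      (∀ j : Fin (Ny - 1), 0 < P.ePlus (WSLD.gridPoint P.yL P.yR Ny j)) →
      ∀ τ : ℝ, 0 < τ →
        spectralRadius ℂ ((P.amplification Nx Ny τ).map (fun t : ℝ => (t : ℂ))) < 1) ∧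
    -- if the coefficients are bounded and bounded away from zero, the constant is uniform
    ((∃ c M : ℝ, 0 < c ∧ ∀ x ∈ Set.Ioo P.xL P.xR, c ≤ P.dPlus x ∧ P.dPlus x ≤ M) →
      (∃ c M : ℝ, 0 < c ∧ ∀ y ∈ Set.Ioo P.yL P.yR, c ≤ P.ePlus y ∧ P.ePlus y ≤ M) →
      ∃ K : ℝ, ∀ Nx Ny : ℕ, 0 < Nx → 0 < Ny → ∀ τ : ℝ, 0 < τ → P.StableWith Nx Ny τ K) := by
  have hHx : ∀ Nx v, v ≠ 0 → v ⬝ᵥ (WSLD.twoSided P.α κα P.shifts (Nx - 1) *ᵥ v) < 0 :=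
    fun _ => WSLD.twoSided_neg_def hS hα hSα hκα
  have hHy : ∀ Ny v, v ≠ 0 → v ⬝ᵥ (WSLD.twoSided P.β κβ P.shifts (Ny - 1) *ᵥ v) < 0 :=
    fun _ => WSLD.twoSided_neg_def hS hβ hSβ hκβ
  -- The weight is chosen before `τ`; this is what makes the constant independent of the time step.
  have hweak : ∀ Nx Ny : ℕ, ∃ M : Matrix (WSLD.Node Nx Ny) (WSLD.Node Nx Ny) ℝ, M.PosDef ∧
      (0 < Nx → 0 < Ny → ∀ τ : ℝ, 0 < τ →
        WSLD.Dissipative M (P.calAx Nx Ny τ) ∧ WSLD.Dissipative M (P.calAy Nx Ny τ)) := by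
    intro Nx Ny
    have hMx := WSLD.posDef_degenerateWeight (d := P.dGrid Nx)
      (fun i => hd _ (WSLD.gridPoint_mem_Ioo hx i)) (hHx Nx)
    have hMy := WSLD.posDef_degenerateWeight (d := P.eGrid Ny)
      (fun j => he _ (WSLD.gridPoint_mem_Ioo hy j)) (hHy Ny)
    refine ⟨_, hMy.kronecker hMx, fun hNx hNy τ hτ => ⟨?_, ?_⟩⟩
    · rw [WSLD.Problem.calAx_eq (hD Nx)]
      exact ((WSLD.dissipative_degenerateWeight (hHx Nx)).kronecker_right hMy).smul
        (WSLD.Problem.coeff_pos hx hNx hτ).le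
    · rw [WSLD.Problem.calAy_eq (hE Ny)]
      exact ((WSLD.dissipative_degenerateWeight (hHy Ny)).kronecker_left hMx).smul
        (WSLD.Problem.coeff_pos hy hNy hτ).le
  -- The weight is recorded as an explicit diagonal matrix so that its entries can be bounded
  -- uniformly in the grid.
  have hstrong : ∀ Nx Ny : ℕ, 0 < Nx → 0 < Ny → (∀ i, 0 < P.dGrid Nx i) →
      (∀ j, 0 < P.eGrid Ny j) → ∀ τ : ℝ, 0 < τ →
      ∃ M : Matrix (WSLD.Node Nx Ny) (WSLD.Node Nx Ny) ℝ,
        M = Matrix.diagonal (fun k => (P.eGrid Ny k.1)⁻¹ * (P.dGrid Nx k.2)⁻¹) ∧ M.PosDef ∧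
        WSLD.Dissipative M (P.calAx Nx Ny τ) ∧ WSLD.StrictlyDissipative M (P.calAy Nx Ny τ) := by
    intro Nx Ny hNx hNy hdp hep τ hτ
    have hMx := WSLD.posDef_diagonal_inv hdp
    have hMy := WSLD.posDef_diagonal_inv hep
    refine ⟨_, Matrix.diagonal_kronecker_diagonal _ _, hMy.kronecker hMx, ?_, ?_⟩
    · rw [WSLD.Problem.calAx_eq (hD Nx)]
      exact ((WSLD.strictlyDissipative_diagonal_inv hdp (hHx Nx)).dissipative.kronecker_right hMy).smul
        (WSLD.Problem.coeff_pos hx hNx hτ).le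
    · rw [WSLD.Problem.calAy_eq (hE Ny)]
      exact ((WSLD.strictlyDissipative_diagonal_inv hep (hHy Ny)).kronecker_left hMx).smul
        (WSLD.Problem.coeff_pos hy hNy hτ)
  refine ⟨fun Nx Ny hNx hNy τ hτ => ?_, fun Nx Ny hNx hNy => ?_,
    fun Nx Ny hNx hNy hdp hep τ hτ => ?_, ?_⟩
  · obtain ⟨M, hM, h⟩ := hweak Nx Ny
    obtain ⟨hX, hY⟩ := h hNx hNy τ hτ
    exact (hX.isUnit_one_sub hM).mul (hY.isUnit_one_sub hM)
  · obtain ⟨M, hM, h⟩ := hweak Nx Ny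
    obtain ⟨m, m', hm, hb⟩ := WSLD.exists_energy_bounds hM
    refine ⟨√(m' / m), fun τ hτ => ?_⟩
    obtain ⟨hX, hY⟩ := h hNx hNy τ hτ
    exact WSLD.Problem.stableWith_of_dissipative hM hX hY hm hb
  · obtain ⟨M, -, hM, hX, hY⟩ := hstrong Nx Ny hNx hNy hdp hep τ hτ
    exact WSLD.Problem.spectralRadius_amplification_lt_one hM hX hY
  · rintro ⟨c, C, hc, hdb⟩ ⟨c', C', hc', heb⟩
    have hC : 0 < C := by
      obtain ⟨x, hxm⟩ := Set.nonempty_Ioo.mpr hx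
      exact hc.trans_le ((hdb x hxm).1.trans (hdb x hxm).2)
    have hC' : 0 < C' := by
      obtain ⟨y, hym⟩ := Set.nonempty_Ioo.mpr hy
      exact hc'.trans_le ((heb y hym).1.trans (heb y hym).2)
    -- The diagonal weight has all its entries between `C'⁻¹ C⁻¹` and `c'⁻¹ c⁻¹`.
    refine ⟨√((c'⁻¹ * c⁻¹) / (C'⁻¹ * C⁻¹)), fun Nx Ny hNx hNy τ hτ => ?_⟩
    have hdg : ∀ i, c ≤ P.dGrid Nx i ∧ P.dGrid Nx i ≤ C := fun i =>
      hdb _ (WSLD.gridPoint_mem_Ioo hx i)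
    have heg : ∀ j, c' ≤ P.eGrid Ny j ∧ P.eGrid Ny j ≤ C' := fun j =>
      heb _ (WSLD.gridPoint_mem_Ioo hy j)
    have hdp : ∀ i, 0 < P.dGrid Nx i := fun i => hc.trans_le (hdg i).1
    have hep : ∀ j, 0 < P.eGrid Ny j := fun j => hc'.trans_le (heg j).1
    obtain ⟨M, rfl, hM, hX, hY⟩ := hstrong Nx Ny hNx hNy hdp hep τ hτ
    refine WSLD.Problem.stableWith_of_dissipative hM hX hY.dissipative (by positivity)
      (WSLD.Problem.energy_diagonal_bounds fun k => ⟨?_, ?_⟩)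
    · exact mul_le_mul (inv_anti₀ (hep _) (heg _).2) (inv_anti₀ (hdp _) (hdg _).2)
        (by positivity) (inv_pos.mpr (hep _)).le
    · exact mul_le_mul (inv_anti₀ hc' (heg _).1) (inv_anti₀ hc (hdg _).1)
        (inv_pos.mpr (hdp _)).le (by positivity)
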